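/- Let $n\ge 2$ and $N_n=\{1,\dots,n\}$. Let $\Gamma_n\subseteq\mathbb R^{2^{N_n}}$ be the cone of polymatroid rank functions, i.e. of all $\mathbf h$ with $\mathbf h(\emptyset)=0$, $\mathbf h(A)\ge 0$, $\mathbf h(A)\le\mathbf h(B)$ for $A\subseteq B$, and $\mathbf h(A)+\mathbf h(B)\ge\mathbf h(A\cap B)+\mathbf h(A\cup B)$. Let $\Gamma_n^*$ be the set of entropy functions $A\mapsto H(X_A)$ (natural logarithm) of random vectors $(X_i)_{i\in N_n}$ with finite alphabets. A face of $\Gamma_n$ is the intersection of $\Gamma_n$ with a supporting hyperplane, and an extreme ray is a one-dimensional face. Let $U_{1,2}^n$ be the rank-one matroid on $N_n$ in which $1$ and $2$ are parallel and all other elements are loops. For a matroid $M$ on $N_n$ with rank function $\mathbf r_M$ put $\chi_M=\{v\in\mathbb Z: v\ge2,\ \log v\cdot\mathbf r_M\in\Gamma_n^*\}$. Let $(M,U_{1,2}^n)$ denote the set of all $a\,\mathbf r_M+b\,\mathbf r_{U_{1,2}^n}$ with $a,b\ge 0$. Write $(a,b)$ for such a point and call it entropic if it lies in $\Gamma_n^*$.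 If $(M,U_{1,2}^n)$ is a two-dimensional face of $\Gamma_n$, it is called * Matúš-type if $(a,b)$ is entropic whenever $a+b\ge\log v$ and $\log(v-1)<a<\log v$ for some $v\in\chi_M$, and is non-entropic whenever $a+b<\log\lceil e^a\rceil$; * Chen–Yeung-type if $(a,b)$ is entropic whenever $b>0$ and $a=\log v$ for some $v\in\chi_M$, and is non-entropic whenever $b>0$ and $a\ne\log v$ for every positive integer $v$. **Theorem.** Let $M$ be a matroid on $N_n$ of rank at least $2$ whose rank function lies in an extreme ray of $\Gamma_n$. Then $(M,U_{1,2}^n)$ is a two-dimensional face of $\Gamma_n$. If $M$ has rank $2$ and has a three-element circuit $\{1,2,i\}$ such that every $j\in N_n\setminus\{1,2,i\}$ is parallel to $i$ or a loop of $M$, then this face is Matúš-type and not Chen–Yeung-type. Otherwise it is Chen–Yeung-type and, provided that $\chi_M\neq\emptyset$, not Matúš-type. -/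

import Mathlib

open scoped BigOperators

/-- Real set functions on the ground set `Fin n` (whose elements `0, 1, 2, …` stand for the
elements `1, 2, 3, …` of `N_n`). -/
abbrev EntropySpace (n : ℕ) : Type := Finset (Fin n) → ℝ

/-- The polymatroidal region `Γ_n`. -/
def polymatroidRegion (n : ℕ) : Set (EntropySpace n) :=
  {h | h ∅ = 0 ∧ (∀ A, 0 ≤ h A) ∧ (∀ A B, A ⊆ B → h A ≤ h B) ∧
    ∀ A B, h (A ∩ B) + h (A ∪ B) ≤ h A + h B}

open Classical in
/-- The probability mass function of the subvector `X_A`, when `p` is that of the whole vector. -/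
noncomputable def marginal {n : ℕ} {𝒳 : Fin n → Type} [∀ i, Fintype (𝒳 i)]
    (p : (∀ i, 𝒳 i) → ℝ) (A : Finset (Fin n)) (y : ∀ i : A, 𝒳 i) : ℝ :=
  ∑ x : ∀ i, 𝒳 i, if A.restrict x = y then p x else 0

/-- The entropy function `A ↦ H(X_A)` (in nats) of a random vector with mass function `p`. -/
noncomputable def entropyFunction {n : ℕ} {𝒳 : Fin n → Type} [∀ i, Fintype (𝒳 i)]
    (p : (∀ i, 𝒳 i) → ℝ) : EntropySpace n :=
  fun A => ∑ y : (∀ i : A, 𝒳 i), Real.negMulLog (marginal p A y)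

/-- The entropy region `Γ_n^*`: all entropy functions of random vectors `(X_i)` with finite
alphabets `𝒳 i`. -/
def entropyRegion (n : ℕ) : Set (EntropySpace n) :=
  {h | ∃ (𝒳 : Fin n → Type) (_ : ∀ i, Fintype (𝒳 i)),
    ∃ p ∈ stdSimplex ℝ (∀ i, 𝒳 i), h = entropyFunction p}

/-- `F` is a `d`-dimensional face of `Γ_n`. Every such face contains the origin, so that its
dimension is that of its linear span. -/
def IsFaceOfDim (n d : ℕ) (F : Set (EntropySpace n)) : Prop :=
  F.Nonempty ∧ IsExposed ℝ (polymatroidRegion n) F ∧ Set.finrank ℝ F = d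

/-- The set of all `a r + b u` with `a, b ≥ 0`. -/
def coneOfTwo {n : ℕ} (r u : EntropySpace n) : Set (EntropySpace n) :=
  {h | ∃ a b : ℝ, 0 ≤ a ∧ 0 ≤ b ∧ h = a • r + b • u}

/-- The rank function of a matroid on `Fin n`, as an element of the entropy space. -/
noncomputable def matroidRank {n : ℕ} (M : Matroid (Fin n)) : EntropySpace n :=
  fun A => ((M.eRk (A : Set (Fin n))).toNat : ℝ)

/-- `M` lies in an extreme ray (a one-dimensional face) of `Γ_n`. -/
def InExtremeRay {n : ℕ} (M : Matroid (Fin n)) : Prop :=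
  ∃ R : Set (EntropySpace n), IsFaceOfDim n 1 R ∧ matroidRank M ∈ R

/-- The rank function of `U_{1,k}^n`, the matroid whose restriction to the first `k` elements is
the uniform matroid `U_{1,k}` and in which all other elements are loops. -/
noncomputable def rankOneUniform (n k : ℕ) : EntropySpace n :=
  fun A => ((min 1 (A.filter (fun i => i.val < k)).card : ℕ) : ℝ)

/-- The p-characteristic set of an integer polymatroid with rank function `r`. -/
def pCharSet {n : ℕ} (r : EntropySpace n) : Set ℕ :=
  {v | 2 ≤ v ∧ Real.log v • r ∈ entropyRegion n}

/-- The point `(a, b)` of the face `(P, U_{1,k}^n)` is entropic, `r` being the rank function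
of `P`. -/
def IsEntropicPoint {n : ℕ} (r : EntropySpace n) (k : ℕ) (a b : ℝ) : Prop :=
  a • r + b • rankOneUniform n k ∈ entropyRegion n

/-- `(P, U_{1,k}^n)` is a two-dimensional face of `Γ_n`. -/
def IsTwoDimFace {n : ℕ} (r : EntropySpace n) (k : ℕ) : Prop :=
  IsFaceOfDim n 2 (coneOfTwo r (rankOneUniform n k))

/-- `(P, U_{1,k}^n)` is a two-dimensional face of Matúš type. -/
def IsMatusType {n : ℕ} (r : EntropySpace n) (k : ℕ) : Prop :=
  IsTwoDimFace r k ∧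
  (∀ v ∈ pCharSet r, ∀ a b : ℝ, 0 ≤ a → 0 ≤ b →
    Real.log v ≤ a + b → Real.log ((v : ℝ) - 1) < a → a < Real.log v →
      IsEntropicPoint r k a b) ∧
  (∀ a b : ℝ, 0 ≤ a → 0 ≤ b → a + b < Real.log (⌈Real.exp a⌉ : ℝ) →
      ¬ IsEntropicPoint r k a b)

/-- `(P, U_{1,k}^n)` is a two-dimensional face of Chen–Yeung type. -/
def IsChenYeungType {n : ℕ} (r : EntropySpace n) (k : ℕ) : Prop :=
  IsTwoDimFace r k ∧
  (∀ v ∈ pCharSet r, ∀ b : ℝ, 0 < b → IsEntropicPoint r k (Real.log v) b) ∧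
  (∀ a b : ℝ, 0 ≤ a → 0 < b → (∀ v : ℕ, 0 < v → a ≠ Real.log v) →
      ¬ IsEntropicPoint r k a b)

/-- Two distinct elements are parallel. -/
def AreParallel {n : ℕ} (M : Matroid (Fin n)) (e f : Fin n) : Prop :=
  e ≠ f ∧ M.eRk {e} = 1 ∧ M.eRk {f} = 1 ∧ M.eRk {e, f} = 1

/-- `M` has rank two and has, for some third element `i`, a circuit `{e₁, e₂, i}` such that every
element outside it is parallel to `i` or a loop. -/
def IsExceptional {n : ℕ} (M : Matroid (Fin n)) (e₁ e₂ : Fin n) : Prop :=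
  M.eRank = 2 ∧ ∃ i : Fin n, i ≠ e₁ ∧ i ≠ e₂ ∧ M.IsCircuit {e₁, e₂, i} ∧
    ∀ j : Fin n, j ∉ ({e₁, e₂, i} : Set (Fin n)) → AreParallel M j i ∨ M.IsLoop j

/-!
The cone spanned by the rank function `r` of a matroid on an extreme ray of `Γ_n` and by the rank
function of `U_{1,2}^n` is a two-dimensional face of `Γ_n`, and its type is determined by whether
the matroid is essentially `U_{2,3}`.

The face is cut out by the second differences that vanish at both generators. Entropic points are
analysed through the equality cases of the Shannon inequalities, and constructed by adding
independent random vectors.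
-/

open scoped BigOperators

/-! Write `r` for the rank function of the matroid, `e`, `f` for its first two elements and `u =
pairRank e f`.

Face. `Γ_n` is cut out by the nonnegativity of second differences, and those of `u` are nonzero only
in directions from `{e, f}` at sets `K` avoiding `e` and `f`. Let `h` in `Γ_n` satisfy every
constraint tight at both `r` and `u`. The point is that `secondDiff h e f K` takes one value `b`
over all such `K` at which `r` is tight (`IsTightOn.exists_secondDiff_eq`). These `K` either span
`e` or `f`, or leave the pair independent in the contraction by `K`. Within each class the value
moves along one-element steps, and the two classes are joined through a line of a contraction
(`IsTightOn.secondDiff_free_eq_spanned`). Then `h - b u` is tight wherever `r` is, so extremality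
makes it a multiple of `r`.

Dichotomy. Extremality also forbids separators (`no_separator`). If the complement of `{e, f}` has
rank at most one, this forces the exceptional matroid. Otherwise there are `j`, `k` outside `{e, f}`
that are independent but become parallel after contracting some `Z` (`exists_linked`).

Linked case. At an entropic point `(a, b)`, the variables at `j` and `k` are independent of each
other and of `X_Z`, and determine each other given `X_Z`. Jointly possible values then have equal
probabilities, and by independence all pairs of values are jointly possible. Hence `X_j` is uniform
and `a = log v` (`exists_ent_eq_log`). Conversely, independent copies of `u` may be added to `log v
• r`.

Exceptional case. Now `X_e`, `X_f`, `X_i` behave like a three-point line with `H(X_i) = a` and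
`H(X_e) = a + b`. Each value of `X_e` is compatible with every value of `X_i`, hence with as many
equiprobable values of `X_f`, so `a + b` is at least the logarithm of the support size of `X_i`
(`log_ceil_exp_le_ent`). Conversely, take `X_e` uniform on a cyclic group, `X_i` independent of
entropy `a`, and `X_f = X_e + X_i` (`IsExceptionalRank.mem_entropyRegion`). -/

variable {n : ℕ}

/-! ### Second differences and the polymatroid cone -/

/-- The second difference `h(K ∪ i) + h(K ∪ j) - h(K) - h(K ∪ {i, j})`. -/
def secondDiff (h : EntropySpace n) (i j : Fin n) (K : Finset (Fin n)) : ℝ :=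
  h (insert i K) + h (insert j K) - h K - h (insert i (insert j K))

theorem secondDiff_self (h : EntropySpace n) (i : Fin n) (K : Finset (Fin n)) :
    secondDiff h i i K = h (insert i K) - h K := by
  simp only [secondDiff, Finset.insert_idem]; ring

theorem secondDiff_comm (h : EntropySpace n) (i j : Fin n) (K : Finset (Fin n)) :
    secondDiff h i j K = secondDiff h j i K := by
  simp only [secondDiff, Finset.insert_comm i j]; ring

theorem secondDiff_add (h g : EntropySpace n) (i j : Fin n) (K : Finset (Fin n)) :
    secondDiff (h + g) i j K = secondDiff h i j K + secondDiff g i j K := by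
  simp only [secondDiff, Pi.add_apply]; ring

theorem secondDiff_smul (c : ℝ) (h : EntropySpace n) (i j : Fin n) (K : Finset (Fin n)) :
    secondDiff (c • h) i j K = c * secondDiff h i j K := by
  simp only [secondDiff, Pi.smul_apply, smul_eq_mul]; ring

theorem secondDiff_sub (h g : EntropySpace n) (i j : Fin n) (K : Finset (Fin n)) :
    secondDiff (h - g) i j K = secondDiff h i j K - secondDiff g i j K := by
  simp only [secondDiff, Pi.sub_apply]; ring

/-- Both sides are the third difference in the directions `i`, `j`, `k`, which is symmetric. This
exchanges directions when following `secondDiff h e f` from `K` to `insert j K`. -/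
theorem secondDiff_chain (h : EntropySpace n) (i j k : Fin n) (K : Finset (Fin n)) :
    secondDiff h i j K - secondDiff h i j (insert k K) =
      secondDiff h i k K - secondDiff h i k (insert j K) := by
  simp only [secondDiff, Finset.insert_comm k j]; ring

theorem increment_antitone {h : EntropySpace n} (hD : ∀ i j K, 0 ≤ secondDiff h i j K)
    {K L : Finset (Fin n)} (hKL : K ⊆ L) (i : Fin n) :
    h (insert i L) - h L ≤ h (insert i K) - h K := by
  have key : ∀ T : Finset (Fin n), h (insert i (T ∪ K)) - h (T ∪ K) ≤ h (insert i K) - h K := by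
    intro T
    induction T using Finset.induction_on with
    | empty => simp
    | insert t T _ ih =>
      have := hD i t (T ∪ K)
      rw [Finset.insert_union]
      simp only [secondDiff] at this
      linarith
  simpa [Finset.union_eq_left.2 hKL] using key L

theorem monotone_of_secondDiff {h : EntropySpace n} (hD : ∀ i j K, 0 ≤ secondDiff h i j K)
    {K L : Finset (Fin n)} (hKL : K ⊆ L) : h K ≤ h L := by
  have key : ∀ T : Finset (Fin n), h K ≤ h (T ∪ K) := by
    intro T
    induction T using Finset.induction_on with
    | empty => simp
    | insert t T _ ih =>
      have := hD t t (T ∪ K)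
      rw [secondDiff_self] at this
      rw [Finset.insert_union]
      linarith
  simpa [Finset.union_eq_left.2 hKL] using key L

theorem submodular_of_secondDiff {h : EntropySpace n} (hD : ∀ i j K, 0 ≤ secondDiff h i j K)
    (A B : Finset (Fin n)) :
    h (A ∩ B) + h (A ∪ B) ≤ h A + h B := by
  have key : ∀ T : Finset (Fin n), h (T ∪ B) - h B ≤ h (T ∪ (A ∩ B)) - h (A ∩ B) := by
    intro T
    induction T using Finset.induction_on with
    | empty => simp
    | insert t T _ ih =>
      have := increment_antitone hD
        (Finset.union_subset_union_right (s := T) (Finset.inter_subset_right (s₁ := A) (s₂ := B))) t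
      rw [Finset.insert_union, Finset.insert_union]
      linarith
  have := key A
  rw [Finset.union_eq_left.2 Finset.inter_subset_left] at this
  linarith

/-- The elemental inequalities suffice. The diagonal case `i = j` is an increment, so monotonicity
needs no separate treatment. -/
theorem mem_polymatroidRegion_iff {h : EntropySpace n} :
    h ∈ polymatroidRegion n ↔ h ∅ = 0 ∧ ∀ i j K, 0 ≤ secondDiff h i j K := by
  constructor
  · rintro ⟨h0, -, hm, hs⟩
    refine ⟨h0, fun i j K => ?_⟩
    have h1 := hs (insert i K) (insert j K)
    have h2 : h K ≤ h (insert i K ∩ insert j K) := hm _ _ (Finset.subset_inter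
      (Finset.subset_insert _ _) (Finset.subset_insert _ _))
    have h3 : insert i K ∪ insert j K = insert i (insert j K) := by
      ext x; simp only [Finset.mem_union, Finset.mem_insert]; tauto
    rw [h3] at h1
    simp only [secondDiff]; linarith
  · rintro ⟨h0, hD⟩
    exact ⟨h0, fun A => h0 ▸ monotone_of_secondDiff hD (Finset.empty_subset A),
      fun A B hAB => monotone_of_secondDiff hD hAB, submodular_of_secondDiff hD⟩

theorem zero_mem_polymatroidRegion : (0 : EntropySpace n) ∈ polymatroidRegion n := by
  rw [mem_polymatroidRegion_iff]; simp [secondDiff]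

theorem add_mem_polymatroidRegion {h g : EntropySpace n} (hh : h ∈ polymatroidRegion n)
    (hg : g ∈ polymatroidRegion n) : h + g ∈ polymatroidRegion n := by
  rw [mem_polymatroidRegion_iff] at *
  refine ⟨by simp [hh.1, hg.1], fun i j K => ?_⟩
  rw [secondDiff_add]
  exact add_nonneg (hh.2 i j K) (hg.2 i j K)

theorem smul_mem_polymatroidRegion {c : ℝ} (hc : 0 ≤ c) {h : EntropySpace n}
    (hh : h ∈ polymatroidRegion n) : c • h ∈ polymatroidRegion n := by
  rw [mem_polymatroidRegion_iff] at *
  refine ⟨by simp [hh.1], fun i j K => ?_⟩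
  rw [secondDiff_smul]
  exact mul_nonneg hc (hh.2 i j K)

/-! ### Extreme rays: rigidity and absence of separators -/

/-- `r` is a nonzero point of a one-dimensional face: the only way to split it inside `Γ_n` is
into multiples of itself. -/
theorem eq_smul_of_add_eq {r g g' : EntropySpace n} {R : Set (EntropySpace n)}
    (hR : IsFaceOfDim n 1 R) (hr : r ∈ R) (hr0 : r ≠ 0) (hg : g ∈ polymatroidRegion n)
    (hg' : g' ∈ polymatroidRegion n) (hsum : g + g' = r) : ∃ c : ℝ, g = c • r := by
  obtain ⟨hne, hex, hdim⟩ := hR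
  obtain ⟨l, rfl⟩ := hex hne
  have hrΓ : r ∈ polymatroidRegion n := hr.1
  -- Comparing with `0` and `2r` shows that the maximum of `l` on the cone is `0`, so both summands
  -- of `r` attain it.
  have h0 : l 0 ≤ l r := hr.2 0 zero_mem_polymatroidRegion
  have h2 : l (r + r) ≤ l r := hr.2 _ (add_mem_polymatroidRegion hrΓ hrΓ)
  rw [map_zero] at h0
  rw [map_add] at h2
  have hgl := hr.2 g hg
  have hgl' := hr.2 g' hg'
  have hs : l g + l g' = l r := by rw [← map_add, hsum]
  have hgR : g ∈ {x ∈ polymatroidRegion n | ∀ y ∈ polymatroidRegion n, l y ≤ l x} :=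
    ⟨hg, fun y hy => (hr.2 y hy).trans (by linarith)⟩
  have hspan := (finrank_eq_one_iff_of_nonzero' (K := ℝ)
    (V := Submodule.span ℝ {x ∈ polymatroidRegion n | ∀ y ∈ polymatroidRegion n, l y ≤ l x})
    ⟨r, Submodule.subset_span hr⟩ (by simpa [Subtype.ext_iff] using hr0)).1 hdim
  obtain ⟨c, hc⟩ := hspan ⟨g, Submodule.subset_span hgR⟩
  exact ⟨c, (congrArg Subtype.val hc).symm⟩

/-- Rank functions of matroids on `Fin n`. -/
structure IsRankFunction (r : Finset (Fin n) → ℕ) : Prop where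
  empty : r ∅ = 0
  mono : ∀ {A B}, A ⊆ B → r A ≤ r B
  submod : ∀ A B, r (A ∩ B) + r (A ∪ B) ≤ r A + r B
  insert_le : ∀ i A, r (insert i A) ≤ r A + 1

/-- The real-valued version of an integer set function. -/
def realRank (r : Finset (Fin n) → ℕ) : EntropySpace n := fun A => (r A : ℝ)

theorem IsRankFunction.mem_polymatroidRegion {r : Finset (Fin n) → ℕ} (hr : IsRankFunction r) :
    realRank r ∈ polymatroidRegion n :=
  ⟨by simp [realRank, hr.empty], fun A => Nat.cast_nonneg _, fun A B h => by
    simpa [realRank] using hr.mono h, fun A B => by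
    simp only [realRank]; exact_mod_cast hr.submod A B⟩

theorem IsRankFunction.secondDiff_nonneg {r : Finset (Fin n) → ℕ} (hr : IsRankFunction r)
    (i j : Fin n) (K : Finset (Fin n)) : 0 ≤ secondDiff (realRank r) i j K :=
  (mem_polymatroidRegion_iff.1 hr.mem_polymatroidRegion).2 i j K

theorem IsRankFunction.submod_insert {r : Finset (Fin n) → ℕ} (hr : IsRankFunction r)
    (i j : Fin n) (K : Finset (Fin n)) :
    r K + r (insert i (insert j K)) ≤ r (insert i K) + r (insert j K) := by
  have := hr.secondDiff_nonneg i j K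
  simp only [secondDiff, realRank] at this
  have h : (r K : ℝ) + r (insert i (insert j K)) ≤ r (insert i K) + r (insert j K) := by linarith
  exact_mod_cast h

theorem secondDiff_realRank_eq_zero {r : Finset (Fin n) → ℕ} {i j : Fin n} {K : Finset (Fin n)} :
    secondDiff (realRank r) i j K = 0 ↔
      r (insert i K) + r (insert j K) = r K + r (insert i (insert j K)) := by
  simp only [secondDiff, realRank]
  rw [← Nat.cast_inj (R := ℝ)]
  push_cast
  constructor <;> intro h <;> linarith

/-- On an extreme ray, every function satisfying the tight constraints is a multiple. -/
theorem eq_smul_of_tight {r : Finset (Fin n) → ℕ} (hr : IsRankFunction r)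
    {R : Set (EntropySpace n)} (hR : IsFaceOfDim n 1 R) (hrR : realRank r ∈ R)
    (hr0 : realRank r ≠ 0) {h : EntropySpace n} (h0 : h ∅ = 0)
    (ht : ∀ i j K, secondDiff (realRank r) i j K = 0 → secondDiff h i j K = 0) :
    ∃ c : ℝ, h = c • realRank r := by
  obtain ⟨C, hC0, hC⟩ : ∃ C : ℝ, 0 < C ∧ ∀ i j K, |secondDiff h i j K| ≤ C := by
    obtain ⟨C, hC⟩ := (Set.finite_range
      fun x : Fin n × Fin n × Finset (Fin n) => |secondDiff h x.1 x.2.1 x.2.2|).bddAbove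
    refine ⟨max C 1, by positivity, fun i j K => le_max_of_le_left (hC ⟨(i, j, K), rfl⟩)⟩
  -- Nonzero second differences of the integer-valued `r` are at least `1`, so a perturbation by `±
  -- h / C` keeps them nonnegative. The tight ones do not move.
  have mem : ∀ s : ℝ, |s| = C⁻¹ → (1/2 : ℝ) • (realRank r + s • h) ∈ polymatroidRegion n := by
    intro s hs
    refine smul_mem_polymatroidRegion (by norm_num) (mem_polymatroidRegion_iff.2
      ⟨by simp [realRank, hr.empty, h0], fun i j K => ?_⟩)
    rw [secondDiff_add, secondDiff_smul]
    by_cases hz : secondDiff (realRank r) i j K = 0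
    · rw [hz, ht i j K hz]; simp
    · have h1 : (1 : ℝ) ≤ secondDiff (realRank r) i j K := by
        have hle := hr.submod_insert i j K
        rw [secondDiff_realRank_eq_zero] at hz
        have h3 : r K + r (insert i (insert j K)) + 1 ≤ r (insert i K) + r (insert j K) := by omega
        have h4 : (r K : ℝ) + r (insert i (insert j K)) + 1 ≤
          r (insert i K) + r (insert j K) := by exact_mod_cast h3
        simp only [secondDiff, realRank]; linarith
      have h2 : |s * secondDiff h i j K| ≤ 1 := by
        rw [abs_mul, hs]
        calc C⁻¹ * |secondDiff h i j K| ≤ C⁻¹ * C := by gcongr; exact hC i j K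
          _ = 1 := inv_mul_cancel₀ hC0.ne'
      have := (abs_le.1 h2).1
      linarith
  have hCi : 0 < C⁻¹ := inv_pos.2 hC0
  obtain ⟨c, hc⟩ := eq_smul_of_add_eq hR hrR hr0 (mem C⁻¹ (abs_of_pos hCi))
    (mem (-C⁻¹) (by rw [abs_neg, abs_of_pos hCi])) (by ext A; simp; ring)
  refine ⟨C * (2 * c - 1), ?_⟩
  ext A
  have hA := congrFun hc A
  simp only [Pi.smul_apply, Pi.add_apply, smul_eq_mul] at hA ⊢
  have : C⁻¹ * h A = (2 * c - 1) * realRank r A := by linarith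
  rw [mul_assoc, ← this, mul_inv_cancel_left₀ hC0.ne']

/-- A rank function on an extreme ray has no separator. -/
theorem no_separator {r : Finset (Fin n) → ℕ} (hr : IsRankFunction r)
    {R : Set (EntropySpace n)} (hR : IsFaceOfDim n 1 R) (hrR : realRank r ∈ R)
    (A : Finset (Fin n)) (hA : r A ≠ 0) (hA' : r Aᶜ ≠ 0) : r Finset.univ < r A + r Aᶜ := by
  by_contra hlt
  have restr : ∀ T : Finset (Fin n), (fun B => (r (B ∩ T) : ℝ)) ∈ polymatroidRegion n := by
    intro T
    refine ⟨by simp [hr.empty], fun B => Nat.cast_nonneg _, fun B B' hBB => ?_, fun B B' => ?_⟩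
    · show (r (B ∩ T) : ℝ) ≤ r (B' ∩ T)
      exact_mod_cast hr.mono (Finset.inter_subset_inter_right hBB)
    · have := hr.submod (B ∩ T) (B' ∩ T)
      rw [← Finset.inter_inter_distrib_right, ← Finset.union_inter_distrib_right] at this
      show (r (B ∩ B' ∩ T) : ℝ) + r ((B ∪ B') ∩ T) ≤ r (B ∩ T) + r (B' ∩ T)
      exact_mod_cast this
  -- If `A` were a separator, submodularity would split the rank of every `B` along `A` and its
  -- complement.
  have hsum : (fun B => (r (B ∩ A) : ℝ)) + (fun B => (r (B ∩ Aᶜ) : ℝ)) = realRank r := by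
    ext B
    simp only [Pi.add_apply, realRank]
    have h1 := hr.submod (B ∩ A) (B ∩ Aᶜ)
    have h2 := hr.submod B A
    have h3 := hr.submod (B ∪ A) Aᶜ
    have e1 : (B ∩ A) ∪ (B ∩ Aᶜ) = B := by
      rw [← Finset.inter_union_distrib_left, Finset.union_compl, Finset.inter_univ]
    have e2 : (B ∩ A) ∩ (B ∩ Aᶜ) = ∅ := by
      ext x; simp; tauto
    have e3 : (B ∪ A) ∩ Aᶜ = B ∩ Aᶜ := by
      ext x; simp only [Finset.mem_inter, Finset.mem_union, Finset.mem_compl]; tauto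
    have e4 : (B ∪ A) ∪ Aᶜ = Finset.univ := by
      rw [Finset.union_assoc, Finset.union_compl]; simp
    rw [e1, e2, hr.empty] at h1
    rw [e3, e4] at h3
    have : r (B ∩ A) + r (B ∩ Aᶜ) = r B := by omega
    exact_mod_cast this
  obtain ⟨c, hc⟩ := eq_smul_of_add_eq hR hrR (fun h => hA (by
    have := congrFun h A; simpa [realRank] using this)) (restr A) (restr Aᶜ) hsum
  have h1 := congrFun hc Aᶜ
  have h2 := congrFun hc A
  simp only [Pi.smul_apply, smul_eq_mul, realRank, Finset.inter_self] at h1 h2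
  rw [Finset.inter_comm, Finset.inter_compl, hr.empty] at h1
  have hc0 : c = 0 := by
    rcases mul_eq_zero.1 (h1.symm.trans Nat.cast_zero) with h | h
    · exact h
    · exact absurd (by exact_mod_cast h) hA'
  rw [hc0, zero_mul] at h2
  exact hA (by exact_mod_cast h2)

/-! ### The two-dimensional face -/

/-- The rank function of the rank-one matroid in which `e`, `f` are parallel and all other elements
are loops. -/
noncomputable def pairRank (e f : Fin n) : EntropySpace n :=
  fun A => if e ∈ A ∨ f ∈ A then 1 else 0

theorem secondDiff_pairRank (e f i j : Fin n) (K : Finset (Fin n)) :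
    secondDiff (pairRank e f) i j K =
      if (e ∉ K ∧ f ∉ K) ∧ (i = e ∨ i = f) ∧ (j = e ∨ j = f) then 1 else 0 := by
  simp only [secondDiff, pairRank, Finset.mem_insert, @eq_comm _ i, @eq_comm _ j]
  grind

theorem pairRank_mem_polymatroidRegion (e f : Fin n) : pairRank e f ∈ polymatroidRegion n := by
  rw [mem_polymatroidRegion_iff]
  refine ⟨by simp [pairRank], fun i j K => ?_⟩
  rw [secondDiff_pairRank]
  split_ifs <;> norm_num

theorem IsRankFunction.insert_eq_of_subset {r : Finset (Fin n) → ℕ} (hr : IsRankFunction r)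
    {i : Fin n} {K L : Finset (Fin n)} (hKL : K ⊆ L) (h : r (insert i K) = r K) :
    r (insert i L) = r L := by
  have h1 := hr.submod (insert i K) L
  have h2 : r K ≤ r (insert i K ∩ L) :=
    hr.mono (Finset.subset_inter (Finset.subset_insert _ _) hKL)
  rw [Finset.insert_union, Finset.union_eq_right.2 hKL] at h1
  have h3 := hr.mono (Finset.subset_insert i L)
  omega

theorem IsRankFunction.eq_of_forall_insert {r : Finset (Fin n) → ℕ} (hr : IsRankFunction r)
    {K L : Finset (Fin n)} (hKL : K ⊆ L) (h : ∀ i ∈ L, r (insert i K) = r K) : r L = r K := by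
  have key : ∀ T ⊆ L, r (T ∪ K) = r K := by
    intro T
    induction T using Finset.induction_on with
    | empty => simp
    | insert t T _ ih =>
      intro hT
      rw [Finset.insert_subset_iff] at hT
      rw [Finset.insert_union,
        hr.insert_eq_of_subset Finset.subset_union_right (h t hT.1), ih hT.2]
  have := key L subset_rfl
  rwa [Finset.union_eq_left.2 hKL] at this

/-- `h` satisfies with equality every constraint that is tight at both `r` and `pairRank e f`. -/
def IsTightOn (r : Finset (Fin n) → ℕ) (e f : Fin n) (h : EntropySpace n) : Prop :=
  ∀ i j K, secondDiff (realRank r) i j K = 0 → secondDiff (pairRank e f) i j K = 0 →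
    secondDiff h i j K = 0

section Tight

variable {r : Finset (Fin n) → ℕ} {e f : Fin n} {h : EntropySpace n}

theorem IsTightOn.symm (hT : IsTightOn r e f h) : IsTightOn r f e h := by
  intro i j K h1 h2
  refine hT i j K h1 ?_
  rw [← h2, secondDiff_pairRank, secondDiff_pairRank]
  simp only [and_comm, or_comm]

theorem IsTightOn.right (hT : IsTightOn r e f h) {i j : Fin n} {K : Finset (Fin n)}
    (hr : secondDiff (realRank r) i j K = 0) (hje : j ≠ e) (hjf : j ≠ f) :
    secondDiff h i j K = 0 :=
  hT i j K hr (by rw [secondDiff_pairRank]; simp [hje, hjf])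

theorem IsTightOn.of_mem (hT : IsTightOn r e f h) {i j : Fin n} {K : Finset (Fin n)}
    (hr : secondDiff (realRank r) i j K = 0) (hK : e ∈ K ∨ f ∈ K) :
    secondDiff h i j K = 0 :=
  hT i j K hr (by rw [secondDiff_pairRank, if_neg]; tauto)

/-- By `secondDiff_chain` it is enough that one of the pairs `e, j` and `f, j` is tight for `r` at
`K`. If neither is, then in the contraction by `K` the element `j` is parallel to both `e` and `f`.
These are then parallel to each other, contrary to tightness of `e, f`. -/
theorem IsTightOn.secondDiff_insert (hr : IsRankFunction r) (hT : IsTightOn r e f h)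
    {K : Finset (Fin n)} {j : Fin n} (hje : j ≠ e) (hjf : j ≠ f)
    (h1 : secondDiff (realRank r) e f K = 0)
    (h2 : secondDiff (realRank r) e f (insert j K) = 0) :
    secondDiff h e f (insert j K) = secondDiff h e f K := by
  have c1 := secondDiff_chain h e f j K
  have c2 := secondDiff_chain (realRank r) e f j K
  have c3 := secondDiff_chain h f e j K
  have c4 := secondDiff_chain (realRank r) f e j K
  simp only [secondDiff_comm _ f e] at c3 c4
  by_cases hA : secondDiff (realRank r) e j K = 0
  · have hB : secondDiff (realRank r) e j (insert f K) = 0 := by linarith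
    have := hT.right hA hje hjf
    have := hT.right hB hje hjf
    linarith
  by_cases hA' : secondDiff (realRank r) f j K = 0
  · have hB : secondDiff (realRank r) f j (insert e K) = 0 := by linarith
    have := hT.right hA' hje hjf
    have := hT.right hB hje hjf
    linarith
  exfalso
  rw [secondDiff_realRank_eq_zero] at hA hA' h1
  have a1 := hr.insert_le e K
  have a2 := hr.insert_le f K
  have a3 := hr.insert_le j K
  have a4 := hr.submod_insert e j K
  have a5 := hr.submod_insert f j K
  have a6 := hr.mono (Finset.subset_insert e (insert j K))
  have a7 := hr.mono (Finset.subset_insert f (insert j K))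
  have a8 := hr.submod_insert e f (insert j K)
  have a9 : r (insert e (insert f K)) ≤ r (insert e (insert f (insert j K))) :=
    hr.mono (Finset.insert_subset_insert _ (Finset.insert_subset_insert _
      (Finset.subset_insert _ _)))
  omega

/-- Spanning `e` or `f` persists upwards, so every set between `K` and `L` is tight and elements can
be added one at a time. -/
theorem IsTightOn.secondDiff_of_spanned (hr : IsRankFunction r) (hT : IsTightOn r e f h)
    {K L : Finset (Fin n)} (hKL : K ⊆ L) (heL : e ∉ L) (hfL : f ∉ L)
    (hK : r (insert e K) = r K ∨ r (insert f K) = r K) :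
    secondDiff h e f L = secondDiff h e f K := by
  have tight : ∀ T, K ⊆ T → secondDiff (realRank r) e f T = 0 := by
    intro T hT
    rw [secondDiff_realRank_eq_zero]
    rcases hK with hK | hK
    · rw [hr.insert_eq_of_subset hT hK,
        hr.insert_eq_of_subset (hT.trans (Finset.subset_insert f T)) hK]
    · rw [Finset.insert_comm, hr.insert_eq_of_subset hT hK,
        hr.insert_eq_of_subset (hT.trans (Finset.subset_insert e T)) hK, add_comm]
  have key : ∀ T ⊆ L, secondDiff h e f (T ∪ K) = secondDiff h e f K := by
    intro T
    induction T using Finset.induction_on with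
    | empty => simp
    | insert t T _ ih =>
      intro hTL
      rw [Finset.insert_subset_iff] at hTL
      rw [Finset.insert_union, hT.secondDiff_insert hr (fun he => heL (he ▸ hTL.1))
        (fun he => hfL (he ▸ hTL.1)) (tight _ Finset.subset_union_right)
        (tight _ (Finset.subset_union_right.trans (Finset.subset_insert _ _))), ih hTL.2]
  have := key L subset_rfl
  rwa [Finset.union_eq_left.2 hKL] at this

theorem IsRankFunction.pair_free_of_subset (hr : IsRankFunction r) {K L : Finset (Fin n)}
    (hKL : K ⊆ L) (hL : r (insert e (insert f L)) = r L + 2) :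
    r (insert e (insert f K)) = r K + 2 := by
  have b1 := hr.insert_le e (insert f K)
  have b2 := hr.insert_le f K
  have b3 := hr.insert_le e (insert f L)
  have b4 := hr.insert_le f L
  by_contra hne
  have m1 := hr.mono (Finset.subset_insert f K)
  have m2 := hr.mono (Finset.subset_insert e (insert f K))
  by_cases hf : r (insert f K) = r K
  · have := hr.insert_eq_of_subset hKL hf
    omega
  · have := hr.insert_eq_of_subset (Finset.insert_subset_insert f hKL)
      (show r (insert e (insert f K)) = r (insert f K) by omega)
    omega

/-- In the contraction by `K`, tightness excludes exactly the case of two parallel non-loops. -/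
theorem IsRankFunction.pair_free_iff (hr : IsRankFunction r) {K : Finset (Fin n)}
    (hK : secondDiff (realRank r) e f K = 0) :
    (r (insert e K) = r K ∨ r (insert f K) = r K) ∨ r (insert e (insert f K)) = r K + 2 := by
  rw [secondDiff_realRank_eq_zero] at hK
  have a1 := hr.insert_le e K
  have a2 := hr.insert_le f K
  have a3 := hr.mono (Finset.subset_insert e K)
  have a4 := hr.mono (Finset.subset_insert f K)
  omega

theorem IsRankFunction.pair_free_tight (hr : IsRankFunction r) {K : Finset (Fin n)}
    (hK : r (insert e (insert f K)) = r K + 2) :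
    secondDiff (realRank r) e f K = 0 := by
  rw [secondDiff_realRank_eq_zero]
  have a1 := hr.insert_le e K
  have a2 := hr.insert_le f K
  have a3 := hr.submod_insert e f K
  omega

/-- Independence of the pair persists downwards, so one can descend to the empty set through tight
sets. -/
theorem IsTightOn.secondDiff_of_free (hr : IsRankFunction r) (hT : IsTightOn r e f h)
    {L : Finset (Fin n)} (heL : e ∉ L) (hfL : f ∉ L)
    (hL : r (insert e (insert f L)) = r L + 2) :
    secondDiff h e f L = secondDiff h e f ∅ := by
  induction L using Finset.induction_on with
  | empty => rfl
  | insert t T _ ih =>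
    have hfree := hr.pair_free_of_subset (Finset.subset_insert t T) hL
    simp only [Finset.mem_insert, not_or] at heL hfL
    rw [hT.secondDiff_insert hr (Ne.symm heL.1) (Ne.symm hfL.1) (hr.pair_free_tight hfree)
      (hr.pair_free_tight hL), ih heL.2 hfL.2 hfree]

/-- The case of a line with four points `e`, `f`, `j`, `k`. -/
theorem secondDiff_line {h : EntropySpace n} {K : Finset (Fin n)} {e f j k : Fin n}
    (h1 : secondDiff h f j K = 0) (h2 : secondDiff h e k K = 0)
    (h3 : secondDiff h j k K = 0) (h4 : secondDiff h e k (insert f (insert j K)) = 0)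
    (h5 : secondDiff h j k (insert e (insert f K)) = 0)
    (h6 : secondDiff h f j (insert e (insert k K)) = 0) :
    secondDiff h e f (insert j (insert k K)) = secondDiff h e f K := by
  simp only [secondDiff, Finset.insert_comm k e, Finset.insert_comm k f, Finset.insert_comm k j,
    Finset.insert_comm j e, Finset.insert_comm j f, Finset.insert_comm f e]
    at h1 h2 h3 h4 h5 h6 ⊢
  linarith

/-- The six second differences in the linear identity each have `j` or `k` as a direction, so `u` is
tight there automatically. The rank hypotheses make `r` tight there as well. -/
theorem IsTightOn.secondDiff_line (hT : IsTightOn r e f h)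
    {K : Finset (Fin n)} {j k : Fin n} (hje : j ≠ e) (hjf : j ≠ f) (hke : k ≠ e) (hkf : k ≠ f)
    (he : r (insert e K) = r K + 1) (hf : r (insert f K) = r K + 1)
    (hj : r (insert j K) = r K + 1) (hk : r (insert k K) = r K + 1)
    (hej : r (insert e (insert j K)) = r K + 2) (hek : r (insert e (insert k K)) = r K + 2)
    (hfj : r (insert f (insert j K)) = r K + 2) (hjk : r (insert j (insert k K)) = r K + 2)
    (hef : r (insert e (insert f K)) = r K + 2)
    (hefj : r (insert e (insert f (insert j K))) = r K + 2)
    (hejk : r (insert e (insert j (insert k K))) = r K + 2)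
    (hefk : r (insert e (insert f (insert k K))) = r K + 2)
    (hfjk : r (insert f (insert j (insert k K))) = r K + 2)
    (hefjk : r (insert e (insert f (insert j (insert k K)))) = r K + 2) :
    secondDiff h e f (insert j (insert k K)) = secondDiff h e f K := by
  have tight : ∀ {a b T}, r (insert a T) + r (insert b T) = r T + r (insert a (insert b T)) →
      secondDiff (realRank r) a b T = 0 := fun h => secondDiff_realRank_eq_zero.2 h
  have t2 : secondDiff h f j K = 0 := hT.right (tight (by omega)) hje hjf
  have t3 : secondDiff h e k K = 0 := hT.right (tight (by omega)) hke hkf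
  have t4 : secondDiff h j k K = 0 := hT.right (tight (by omega)) hke hkf
  have t5 : secondDiff h e k (insert f (insert j K)) = 0 := by
    refine hT.right (tight ?_) hke hkf
    rw [Finset.insert_comm k f, Finset.insert_comm k j]
    omega
  have t6 : secondDiff h j k (insert e (insert f K)) = 0 := by
    refine hT.right (tight ?_) hke hkf
    rw [Finset.insert_comm k e, Finset.insert_comm k f, Finset.insert_comm j e,
      Finset.insert_comm j f, Finset.insert_comm j e, Finset.insert_comm j f]
    omega
  have t7 : secondDiff h f j (insert e (insert k K)) = 0 := by
    refine hT.right (tight ?_) hje hjf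
    rw [Finset.insert_comm j e, Finset.insert_comm f e, Finset.insert_comm f e]
    omega
  exact _root_.secondDiff_line t2 t3 t4 t5 t6 t7

/-- Contract a maximal `K` inside `S` that leaves `e, f` independent. Every remaining element of `S`
then lies on the line through `e` and `f`. If one of them is parallel to `e` or `f`, adding it
passes from a free set to a spanned one in a single step. Otherwise two non-parallel ones give the
line of `secondDiff_line`, which passes in two steps. -/
theorem IsTightOn.secondDiff_free_eq_spanned (hr : IsRankFunction r) (hT : IsTightOn r e f h)
    {S : Finset (Fin n)} (heS : e ∉ S) (hfS : f ∉ S)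
    (hS : r (insert e S) = r S ∨ r (insert f S) = r S)
    (h0 : r (insert e (insert f ∅)) = r ∅ + 2) :
    secondDiff h e f S = secondDiff h e f ∅ := by
  obtain ⟨K, hKmax⟩ := (Finset.powerset S |>.filter
    (fun K => r (insert e (insert f K)) = r K + 2)).exists_maximal
      ⟨∅, Finset.mem_filter.2 ⟨Finset.empty_mem_powerset S, h0⟩⟩
  have hK := hKmax.prop
  simp only [Finset.mem_filter, Finset.mem_powerset] at hK
  obtain ⟨hKS, hKfree⟩ := hK
  have heK := fun hh => heS (hKS hh)
  have hfK := fun hh => hfS (hKS hh)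
  rw [← hT.secondDiff_of_free hr heK hfK hKfree]
  have b1 := hr.insert_le e K
  have b2 := hr.insert_le f K
  have b3 := hr.submod_insert e f K
  have hline : ∀ j ∈ S, j ∉ K → r (insert j K) = r K + 1 ∧
      r (insert e (insert f (insert j K))) = r K + 2 := by
    intro j hjS hjK
    have hnot : r (insert e (insert f (insert j K))) ≠ r (insert j K) + 2 := by
      intro hh
      exact hjK (hKmax.le_of_ge (Finset.mem_filter.2 ⟨Finset.mem_powerset.2
        (Finset.insert_subset hjS hKS), hh⟩) (Finset.subset_insert _ _)
          (Finset.mem_insert_self _ _))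
    have c1 := hr.insert_le j K
    have c2 := hr.insert_le e (insert f (insert j K))
    have c3 := hr.insert_le f (insert j K)
    have c4 := hr.mono (Finset.insert_subset_insert e (Finset.insert_subset_insert f
      (Finset.subset_insert j K)))
    omega
  by_cases hpar : ∃ j ∈ S, j ∉ K ∧
      (r (insert e (insert j K)) = r (insert j K) ∨ r (insert f (insert j K)) = r (insert j K))
  · obtain ⟨j, hjS, hjK, hj⟩ := hpar
    have hsub : insert j K ⊆ S := Finset.insert_subset hjS hKS
    have hje : j ≠ e := fun hh => heS (hh ▸ hjS)
    have hjf : j ≠ f := fun hh => hfS (hh ▸ hjS)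
    rw [hT.secondDiff_of_spanned hr hsub heS hfS hj, hT.secondDiff_insert hr hje hjf
      (hr.pair_free_tight hKfree)]
    have d1 := hr.submod_insert e f (insert j K)
    have d2 := hr.mono (Finset.subset_insert e (insert f (insert j K)))
    have d3 := hr.mono (Finset.subset_insert f (insert e (insert j K)))
    rw [Finset.insert_comm f e] at d3
    rw [secondDiff_realRank_eq_zero]
    omega
  push Not at hpar
  have hj2 : ∀ j ∈ S, j ∉ K → r (insert e (insert j K)) = r K + 2 ∧
      r (insert f (insert j K)) = r K + 2 := by
    intro j hjS hjK
    have d1 := hpar j hjS hjK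
    have d2 := hline j hjS hjK
    have d3 := hr.insert_le e (insert j K)
    have d4 := hr.insert_le f (insert j K)
    have d5 := hr.mono (Finset.subset_insert e (insert j K))
    have d6 := hr.mono (Finset.subset_insert f (insert j K))
    omega
  have hex : ∀ T ⊆ S, r T < r S → ∃ j ∈ S, r (insert j T) ≠ r T := by
    intro T hTS hlt
    by_contra hcon
    push Not at hcon
    have := hr.eq_of_forall_insert hTS hcon
    omega
  -- Since `S` spans `e` or `f`, it has the rank of a set containing that element, some `j` and `K`.
  have hrS : r K + 2 ≤ r S := by
    have hKS' : K ≠ S := by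
      rintro rfl
      omega
    obtain ⟨j, hjS, hjK⟩ := Finset.exists_of_ssubset (Finset.ssubset_iff_subset_ne.2 ⟨hKS, hKS'⟩)
    have d1 := hj2 j hjS hjK
    have hsub : insert j K ⊆ S := Finset.insert_subset hjS hKS
    have d2 := hr.mono (Finset.insert_subset_insert e hsub)
    have d3 := hr.mono (Finset.insert_subset_insert f hsub)
    omega
  clear hS h0 hpar b3
  obtain ⟨k, hkS, hk⟩ := hex K hKS (by omega)
  have hkK : k ∉ K := fun hh => hk (by rw [Finset.insert_eq_of_mem hh])
  have hk1 := hline k hkS hkK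
  have hk2 := hj2 k hkS hkK
  obtain ⟨j, hjS, hj⟩ := hex (insert k K) (Finset.insert_subset hkS hKS) (by omega)
  have hjk : j ∉ insert k K := fun hh => hj (by rw [Finset.insert_eq_of_mem hh])
  have hjK : j ∉ K := fun hh => hjk (Finset.mem_insert_of_mem hh)
  have hj1 := hline j hjS hjK
  have hj2 := hj2 j hjS hjK
  have hje : j ≠ e := fun hh => heS (hh ▸ hjS)
  have hjf : j ≠ f := fun hh => hfS (hh ▸ hjS)
  have hke : k ≠ e := fun hh => heS (hh ▸ hkS)
  have hkf : k ≠ f := fun hh => hfS (hh ▸ hkS)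
  have hsub : insert j (insert k K) ⊆ S :=
    Finset.insert_subset hjS (Finset.insert_subset hkS hKS)
  have g1 := hr.insert_le j (insert k K)
  have g2 := (hr.mono (Finset.subset_insert j (insert k K))).lt_of_ne (Ne.symm hj)
  clear hj hk
  have hall : r (insert e (insert f (insert j (insert k K)))) = r K + 2 := by
    have := hr.submod_insert j k (insert e (insert f K))
    have h2 := hr.mono (Finset.insert_subset_insert e (Finset.insert_subset_insert f
      (Finset.insert_subset_insert j (Finset.subset_insert k K))))
    simp only [Finset.insert_comm k e, Finset.insert_comm k f,
      Finset.insert_comm j e, Finset.insert_comm j f] at this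
    omega
  have g3 := hr.mono (Finset.subset_insert e (insert j (insert k K)))
  have g4 := hr.mono (Finset.subset_insert f (insert j (insert k K)))
  have g5 : r (insert e (insert j (insert k K))) ≤
      r (insert e (insert f (insert j (insert k K)))) :=
    hr.mono (Finset.insert_subset_insert e (Finset.subset_insert f _))
  have g6 := hr.mono (Finset.subset_insert e (insert f (insert j (insert k K))))
  have hjk2 : r (insert j (insert k K)) = r K + 2 := by linarith only [g1, g2, hk1.1]
  have hejk : r (insert e (insert j (insert k K))) = r K + 2 := by
    linarith only [g3, g5, hall, hjk2]
  have hfjk : r (insert f (insert j (insert k K))) = r K + 2 := by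
    linarith only [g4, g6, hall, hjk2]
  rw [hT.secondDiff_of_spanned hr hsub heS hfS (Or.inl (hejk.trans hjk2.symm))]
  have h3 := hr.insert_le f (insert e K)
  rw [Finset.insert_comm f e] at h3
  exact hT.secondDiff_line hje hjf hke hkf (by linarith only [b1, h3, hKfree])
    (by linarith only [b2, hr.insert_le e (insert f K), hKfree]) hj1.1 hk1.1 hj2.1 hk2.1 hj2.2 hjk2
    hKfree hj1.2 hejk hk1.2 hfjk hall

theorem IsTightOn.exists_secondDiff_eq (hr : IsRankFunction r)
    (hT : IsTightOn r e f h) (hΓ : h ∈ polymatroidRegion n) :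
    ∃ b : ℝ, 0 ≤ b ∧ ∀ K, e ∉ K → f ∉ K → secondDiff (realRank r) e f K = 0 →
      secondDiff h e f K = b := by
  set S : Finset (Fin n) := {e, f}ᶜ with hSdef
  have heS : e ∉ S := by simp [S]
  have hfS : f ∉ S := by simp [S]
  have hsub : ∀ K, e ∉ K → f ∉ K → K ⊆ S := by
    intro K he hf x hx
    simp only [S, Finset.mem_compl, Finset.mem_insert, Finset.mem_singleton, not_or]
    exact ⟨fun hh => he (hh ▸ hx), fun hh => hf (hh ▸ hx)⟩
  have hnn := (mem_polymatroidRegion_iff.1 hΓ).2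
  by_cases hS : r (insert e S) = r S ∨ r (insert f S) = r S
  · refine ⟨secondDiff h e f S, hnn _ _ _, fun K he hf hK => ?_⟩
    rcases hr.pair_free_iff hK with hK | hK
    · exact (hT.secondDiff_of_spanned hr (hsub K he hf) heS hfS hK).symm
    · rw [hT.secondDiff_of_free hr he hf hK, hT.secondDiff_free_eq_spanned hr heS hfS hS
        (hr.pair_free_of_subset (Finset.empty_subset K) hK)]
  · refine ⟨secondDiff h e f ∅, hnn _ _ _, fun K he hf hK => ?_⟩
    rcases hr.pair_free_iff hK with hK | hK
    · exact absurd (hK.imp (hr.insert_eq_of_subset (hsub K he hf))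
        (hr.insert_eq_of_subset (hsub K he hf))) hS
    · exact hT.secondDiff_of_free hr he hf hK

/-- Subtracting `b u` corrects just the differences where `u` is not tight. The mixed ones equal
`b`, and the diagonal ones reduce to these by `hspan`. -/
theorem IsTightOn.exists_sub_tight (hr : IsRankFunction r)
    (hT : IsTightOn r e f h) (hΓ : h ∈ polymatroidRegion n) :
    ∃ b : ℝ, 0 ≤ b ∧ ∀ i j K, secondDiff (realRank r) i j K = 0 →
      secondDiff (h - b • pairRank e f) i j K = 0 := by
  obtain ⟨b, hb, hd⟩ := hT.exists_secondDiff_eq hr hΓ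
  refine ⟨b, hb, fun i j K hK => ?_⟩
  rw [secondDiff_sub, secondDiff_smul]
  -- If `K` spans `x`, the increment of `h` at `x` vanishes once `y` has been added, so the diagonal
  -- and mixed differences at `K` agree.
  have hspan : ∀ x y : Fin n, IsTightOn r x y h → secondDiff (realRank r) x x K = 0 →
      secondDiff (realRank r) x y K = 0 ∧ secondDiff h x x K = secondDiff h x y K := by
    intro x y hT hx
    have hx' : r (insert x K) = r K := by
      rw [secondDiff_realRank_eq_zero, Finset.insert_idem] at hx; omega
    have h1 := hr.insert_eq_of_subset (Finset.subset_insert y K) hx'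
    have h2 : secondDiff h x x (insert y K) = 0 := by
      refine hT.of_mem ?_ (Or.inr (Finset.mem_insert_self _ _))
      rw [secondDiff_realRank_eq_zero, Finset.insert_idem]; omega
    refine ⟨secondDiff_realRank_eq_zero.2 (by omega), ?_⟩
    simp only [secondDiff, Finset.insert_idem] at h2 ⊢
    linarith
  by_cases hu : secondDiff (pairRank e f) i j K = 0
  · rw [hT i j K hK hu, hu]; ring
  have hu1 : secondDiff (pairRank e f) i j K = 1 := by
    rw [secondDiff_pairRank] at hu ⊢
    split_ifs at hu ⊢ <;> simp_all
  have hcond : (e ∉ K ∧ f ∉ K) ∧ (i = e ∨ i = f) ∧ (j = e ∨ j = f) := by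
    by_contra hcon
    exact hu (by rw [secondDiff_pairRank, if_neg hcon])
  obtain ⟨⟨he, hf⟩, hi, hj⟩ := hcond
  rw [hu1, mul_one, sub_eq_zero]
  rcases hi with rfl | rfl <;> rcases hj with rfl | rfl
  · obtain ⟨h1, h2⟩ := hspan _ _ hT hK
    rw [h2]; exact hd K he hf h1
  · exact hd K he hf hK
  · rw [secondDiff_comm] at hK ⊢
    exact hd K he hf hK
  · obtain ⟨h1, h2⟩ := hspan _ _ hT.symm hK
    rw [h2, secondDiff_comm]
    rw [secondDiff_comm] at h1
    exact hd K he hf h1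

theorem isFaceOfDim_two (hr : IsRankFunction r) {R : Set (EntropySpace n)}
    (hR : IsFaceOfDim n 1 R) (hrR : realRank r ∈ R) (h2 : 2 ≤ r Finset.univ) :
    IsFaceOfDim n 2 (coneOfTwo (realRank r) (pairRank e f)) := by
  have hre : r {e} + 1 ≤ r Finset.univ := by
    have := hr.insert_le e ∅
    rw [hr.empty] at this
    simp only [insert_empty_eq] at this
    omega
  have hre' : (r {e} : ℝ) + 1 ≤ r Finset.univ := by exact_mod_cast hre
  have hr0 : realRank r ≠ 0 := by
    intro hh
    have : (r Finset.univ : ℝ) = 0 := congrFun hh Finset.univ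
    have : r Finset.univ = 0 := by exact_mod_cast this
    omega
  have hu0 : pairRank e f ∅ = 0 := by simp [pairRank]
  have huΓ := pairRank_mem_polymatroidRegion e f
  have hrΓ := hr.mem_polymatroidRegion
  have hr_mem : realRank r ∈ coneOfTwo (realRank r) (pairRank e f) :=
    ⟨1, 0, by norm_num, le_rfl, by simp⟩
  have hu_mem : pairRank e f ∈ coneOfTwo (realRank r) (pairRank e f) :=
    ⟨0, 1, le_rfl, by norm_num, by simp⟩
  refine ⟨⟨_, hr_mem⟩, fun _ => ?_, ?_⟩
  · let T : Finset (Fin n × Fin n × Finset (Fin n)) := Finset.univ.filter fun x =>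
      secondDiff (realRank r) x.1 x.2.1 x.2.2 = 0 ∧ secondDiff (pairRank e f) x.1 x.2.1 x.2.2 = 0
    -- Minus the sum of all jointly tight second differences: it is nonpositive on the cone and
    -- vanishes only where each of them does.
    let L : EntropySpace n →ₗ[ℝ] ℝ :=
      { toFun := fun g => -∑ x ∈ T, secondDiff g x.1 x.2.1 x.2.2
        map_add' := fun g g' => by
          simp only [secondDiff_add, Finset.sum_add_distrib, neg_add]
        map_smul' := fun c g => by
          simp only [secondDiff_smul, ← Finset.mul_sum, RingHom.id_apply, smul_eq_mul, mul_neg] }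
    have hL : ∀ g, L g = -∑ x ∈ T, secondDiff g x.1 x.2.1 x.2.2 := fun _ => rfl
    have hLneg : ∀ g ∈ polymatroidRegion n, L g ≤ 0 := fun g hg => by
      rw [hL, neg_nonpos]
      exact Finset.sum_nonneg fun x _ => (mem_polymatroidRegion_iff.1 hg).2 _ _ _
    refine ⟨LinearMap.toContinuousLinearMap L, ?_⟩
    ext g
    simp only [Set.mem_ofPred_eq, LinearMap.coe_toContinuousLinearMap']
    constructor
    · rintro ⟨a, b, ha, hb, rfl⟩
      refine ⟨add_mem_polymatroidRegion (smul_mem_polymatroidRegion ha hrΓ)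
        (smul_mem_polymatroidRegion hb huΓ), fun y hy => (hLneg y hy).trans (le_of_eq ?_)⟩
      rw [hL, eq_comm, neg_eq_zero]
      refine Finset.sum_eq_zero fun x hx => ?_
      obtain ⟨-, h1, h2⟩ := Finset.mem_filter.1 hx
      rw [secondDiff_add, secondDiff_smul, secondDiff_smul, h1, h2]; ring
    · rintro ⟨hg, hmax⟩
      have hLg := hmax 0 zero_mem_polymatroidRegion
      rw [map_zero] at hLg
      have hsum : ∑ x ∈ T, secondDiff g x.1 x.2.1 x.2.2 = 0 := by
        have := hLneg g hg
        rw [hL] at this hLg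
        linarith
      have hTg : IsTightOn r e f g := fun i j K h1 h2 =>
        (Finset.sum_eq_zero_iff_of_nonneg
          fun x _ => (mem_polymatroidRegion_iff.1 hg).2 _ _ _).1 hsum (i, j, K)
          (Finset.mem_filter.2 ⟨Finset.mem_univ _, h1, h2⟩)
      obtain ⟨b, hb, hbt⟩ := hTg.exists_sub_tight hr hg
      obtain ⟨a, ha⟩ := eq_smul_of_tight hr hR hrR hr0
        (by simp [hu0, (mem_polymatroidRegion_iff.1 hg).1]) hbt
      have hgeq : g = a • realRank r + b • pairRank e f := by rw [← ha]; simp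
      refine ⟨a, b, ?_, hb, hgeq⟩
      -- `u` agrees on `{e}` and the ground set while `r` strictly increases, so monotonicity of `g`
      -- gives `0 ≤ a`.
      have hmono := hg.2.2.1 {e} Finset.univ (Finset.subset_univ _)
      rw [hgeq] at hmono
      simp only [Pi.add_apply, Pi.smul_apply, smul_eq_mul, realRank, pairRank,
        Finset.mem_singleton, Finset.mem_univ, true_or, if_true] at hmono
      by_contra hneg
      nlinarith
  · have hspan : Submodule.span ℝ (coneOfTwo (realRank r) (pairRank e f)) =
        Submodule.span ℝ (Set.range ![realRank r, pairRank e f]) := by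
      apply le_antisymm
      · rw [Submodule.span_le]
        rintro _ ⟨a, b, -, -, rfl⟩
        exact add_mem (Submodule.smul_mem _ _ (Submodule.subset_span ⟨0, rfl⟩))
          (Submodule.smul_mem _ _ (Submodule.subset_span ⟨1, rfl⟩))
      · rw [Submodule.span_le]
        rintro _ ⟨i, rfl⟩
        fin_cases i
        · exact Submodule.subset_span hr_mem
        · exact Submodule.subset_span hu_mem
    have hli : LinearIndependent ℝ ![realRank r, pairRank e f] := by
      rw [LinearIndependent.pair_iff]
      intro s t hst
      have q1 := congrFun hst {e}
      have q2 := congrFun hst Finset.univ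
      simp only [Pi.add_apply, Pi.smul_apply, smul_eq_mul, realRank, pairRank, Pi.zero_apply,
        Finset.mem_singleton, Finset.mem_univ, true_or, if_true] at q1 q2
      have hs : s * ((r Finset.univ : ℝ) - r {e}) = 0 := by linarith
      have hs0 : s = 0 := by
        rcases mul_eq_zero.1 hs with h | h
        · exact h
        · linarith
      subst hs0
      exact ⟨rfl, by linarith⟩
    rw [Set.finrank, hspan, finrank_span_eq_card hli, Fintype.card_fin]

end Tight

/-! ### Matroid ranks and the exceptional configuration -/

/-- The natural-number valued rank function of a matroid on `Fin n`. -/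
noncomputable def natRank (M : Matroid (Fin n)) (A : Finset (Fin n)) : ℕ :=
  (M.eRk (A : Set (Fin n))).toNat

theorem coe_natRank (M : Matroid (Fin n)) (A : Finset (Fin n)) :
    (natRank M A : ℕ∞) = M.eRk (A : Set (Fin n)) :=
  ENat.natCast_toNat (M.eRk_ne_top_iff.2 (M.isRkFinite_set _))

theorem isRankFunction_natRank (M : Matroid (Fin n)) : IsRankFunction (natRank M) where
  empty := by simp [natRank]
  mono h := by
    rw [← Nat.cast_le (α := ℕ∞), coe_natRank, coe_natRank]
    exact M.eRk_mono (by exact_mod_cast h)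
  submod A B := by
    rw [← Nat.cast_le (α := ℕ∞)]
    push_cast
    simp only [coe_natRank, Finset.coe_inter, Finset.coe_union]
    exact M.eRk_inter_add_eRk_union_le _ _
  insert_le i A := by
    rw [← Nat.cast_le (α := ℕ∞)]
    push_cast
    simp only [coe_natRank, Finset.coe_insert]
    exact M.eRk_insert_le_add_one _ _

theorem rankOneUniform_two (h0 : 0 < n) (h1 : 1 < n) :
    rankOneUniform n 2 = pairRank ⟨0, h0⟩ ⟨1, h1⟩ := by
  ext A
  simp only [rankOneUniform, pairRank]
  split_ifs with h
  · have : 0 < (A.filter (fun i => i.val < 2)).card := by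
      rw [Finset.card_pos]
      rcases h with h | h
      · exact ⟨_, Finset.mem_filter.2 ⟨h, by norm_num⟩⟩
      · exact ⟨_, Finset.mem_filter.2 ⟨h, by norm_num⟩⟩
    rw [min_eq_left this]; simp
  · have : A.filter (fun i => i.val < 2) = ∅ := by
      rw [Finset.filter_eq_empty_iff]
      rintro ⟨i, hi⟩ hiA hlt
      have : i = 0 ∨ i = 1 := by simp only at hlt; omega
      rcases this with rfl | rfl <;> tauto
    rw [this]; simp

theorem natRank_univ {M : Matroid (Fin n)} : (natRank M Finset.univ : ℕ∞) = M.eRank := by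
  rw [coe_natRank, Finset.coe_univ, M.eRk_univ_eq]

theorem natRank_eq_iff {M : Matroid (Fin n)} {A : Finset (Fin n)} {k : ℕ} :
    natRank M A = k ↔ M.eRk (A : Set (Fin n)) = k := by
  rw [← coe_natRank, Nat.cast_inj]

theorem indep_iff_natRank {M : Matroid (Fin n)} {A : Finset (Fin n)} :
    M.Indep (A : Set (Fin n)) ↔ natRank M A = A.card := by
  rw [Matroid.indep_iff_eRk_eq_encard_of_finite A.finite_toSet, Set.encard_coe_eq_coe_finsetCard,
    natRank_eq_iff]

/-- The exceptional configuration, in terms of ranks: `{e, f, i}` is a three-point line and all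
other elements are parallel to `i` or loops. -/
structure IsExceptionalRank (r : Finset (Fin n) → ℕ) (e f i : Fin n) : Prop where
  ne_left : i ≠ e
  ne_right : i ≠ f
  univ : r Finset.univ = 2
  pair : r {e, f} = 2
  left : r {e, i} = 2
  right : r {f, i} = 2
  other : ∀ j, j ≠ e → j ≠ f → j ≠ i → r {j} = 0 ∨ (r {j} = 1 ∧ r {j, i} = 1)

theorem isExceptional_iff {M : Matroid (Fin n)} (hE : M.E = Set.univ) {e f : Fin n}
    (hef : e ≠ f) : IsExceptional M e f ↔ ∃ i, IsExceptionalRank (natRank M) e f i := by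
  have hr := isRankFunction_natRank M
  have hcard : ∀ {a b : Fin n}, a ≠ b → (M.Indep {a, b} ↔ natRank M {a, b} = 2) := by
    intro a b hab
    have := indep_iff_natRank (M := M) (A := {a, b})
    rwa [Finset.card_pair hab, Finset.coe_pair] at this
  have hloop : ∀ j, M.IsLoop j ↔ natRank M {j} = 0 := by
    intro j
    rw [natRank_eq_iff, Finset.coe_singleton, Nat.cast_zero,
      Matroid.eRk_eq_zero_iff (hE ▸ Set.subset_univ _), Set.singleton_subset_iff]
    rfl
  have hpar : ∀ j i, AreParallel M j i ↔
      j ≠ i ∧ natRank M {j} = 1 ∧ natRank M {i} = 1 ∧ natRank M {j, i} = 1 := by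
    intro j i
    simp only [AreParallel, natRank_eq_iff, Finset.coe_singleton, Finset.coe_pair, Nat.cast_one]
  have hcirc : ∀ i, i ≠ e → i ≠ f → natRank M Finset.univ = 2 → (M.IsCircuit {e, f, i} ↔
      natRank M {e, f} = 2 ∧ natRank M {e, i} = 2 ∧ natRank M {f, i} = 2) := by
    intro i hie hif hu
    have s1 : ({e, f, i} : Set (Fin n)) \ {e} = {f, i} := by
      ext x; simp only [Set.mem_sdiff, Set.mem_insert_iff, Set.mem_singleton_iff]; grind
    have s2 : ({e, f, i} : Set (Fin n)) \ {f} = {e, i} := by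
      ext x; simp only [Set.mem_sdiff, Set.mem_insert_iff, Set.mem_singleton_iff]; grind
    have s3 : ({e, f, i} : Set (Fin n)) \ {i} = {e, f} := by
      ext x; simp only [Set.mem_sdiff, Set.mem_insert_iff, Set.mem_singleton_iff]; grind
    have hdep : M.Dep {e, f, i} := by
      rw [← Matroid.not_indep_iff (hE ▸ Set.subset_univ _)]
      intro hi
      have := indep_iff_natRank (M := M) (A := {e, f, i})
      rw [Finset.card_eq_three.2 ⟨e, f, i, hef, hie.symm, hif.symm, rfl⟩] at this
      push_cast at this
      have h2 := hr.mono (Finset.subset_univ {e, f, i})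
      have := this.1 hi
      omega
    rw [Matroid.isCircuit_iff_dep_forall_sdiff_singleton_indep]
    simp only [Set.mem_insert_iff, Set.mem_singleton_iff, forall_eq_or_imp, forall_eq, s1, s2, s3,
      hcard hef, hcard hie.symm, hcard hif.symm]
    tauto
  constructor
  · rintro ⟨h2, i, hie, hif, hC, hj⟩
    have hu : natRank M Finset.univ = 2 := by
      have := natRank_univ (M := M)
      rw [h2] at this
      exact_mod_cast this
    obtain ⟨c1, c2, c3⟩ := (hcirc i hie hif hu).1 hC
    refine ⟨i, hie, hif, hu, c1, c2, c3, fun j je jf ji => ?_⟩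
    rcases hj j (by simp [je, jf, ji]) with h | h
    · exact Or.inr ⟨((hpar _ _).1 h).2.1, ((hpar _ _).1 h).2.2.2⟩
    · exact Or.inl ((hloop j).1 h)
  · rintro ⟨i, hi⟩
    refine ⟨?_, i, hi.ne_left, hi.ne_right, (hcirc i hi.ne_left hi.ne_right hi.univ).2
      ⟨hi.pair, hi.left, hi.right⟩, fun j hj => ?_⟩
    · rw [← natRank_univ, hi.univ]; rfl
    · simp only [Set.mem_insert_iff, Set.mem_singleton_iff, not_or] at hj
      rcases hi.other j hj.1 hj.2.1 hj.2.2 with h | h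
      · exact Or.inr ((hloop j).2 h)
      · refine Or.inl ((hpar _ _).2 ⟨hj.2.2, h.1, ?_, h.2⟩)
        have h1 := hr.mono (show ({i} : Finset (Fin n)) ⊆ {j, i} by simp)
        have h2 := hr.insert_le e {i}
        have := hi.left
        omega

/-! ### Connectedness and linked pairs -/

section Connected

variable {r : Finset (Fin n) → ℕ} {e f : Fin n}

theorem IsRankFunction.singleton_le (hr : IsRankFunction r) (i : Fin n) : r {i} ≤ 1 := by
  have := hr.insert_le i ∅
  rwa [hr.empty] at this

theorem IsRankFunction.le_insert (hr : IsRankFunction r) (i : Fin n) (A : Finset (Fin n)) :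
    r A ≤ r (insert i A) := hr.mono (Finset.subset_insert _ _)

theorem IsRankFunction.singleton_le_of_mem (hr : IsRankFunction r) {i : Fin n}
    {A : Finset (Fin n)} (h : i ∈ A) : r {i} ≤ r A := hr.mono (by simpa using h)

/-- Outside the exceptional configuration, `{e, f}ᶜ` has rank at least two. -/
theorem exists_isExceptionalRank (hr : IsRankFunction r) (hef : e ≠ f)
    (hsep : ∀ A, r A ≠ 0 → r Aᶜ ≠ 0 → r Finset.univ < r A + r Aᶜ)
    (hu : 2 ≤ r Finset.univ) (hS : r {e, f}ᶜ ≤ 1) : ∃ i, IsExceptionalRank r e f i := by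
  set S : Finset (Fin n) := {e, f}ᶜ with hSdef
  have hcompl : ∀ x : Fin n, r Finset.univ ≤ r {x} + r {x}ᶜ := by
    intro x
    have := hr.submod {x} {x}ᶜ
    rw [Finset.union_compl] at this
    omega
  have hce : ({e} : Finset (Fin n))ᶜ = insert f S := by
    ext x; simp only [hSdef, Finset.mem_compl, Finset.mem_insert, Finset.mem_singleton]; grind
  have hcf : ({f} : Finset (Fin n))ᶜ = insert e S := by
    ext x; simp only [hSdef, Finset.mem_compl, Finset.mem_insert, Finset.mem_singleton]; grind
  have he := hcompl e
  have hf := hcompl f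
  have se := hsep {e}
  have sf := hsep {f}
  rw [hce] at he se
  rw [hcf] at hf sf
  have be := hr.singleton_le e
  have bf := hr.singleton_le f
  have hunion : r (insert e S) ≤ r {e} + r S := by
    have := hr.submod {e} S
    rw [← Finset.insert_eq] at this
    omega
  have hunion' : r (insert f S) ≤ r {f} + r S := by
    have := hr.submod {f} S
    rw [← Finset.insert_eq] at this
    omega
  -- Without separators a loop among `e`, `f` would make the other a coloop, which is a separator.
  -- This pins all the ranks.
  have hfacts : r {e} = 1 ∧ r {f} = 1 ∧ r S = 1 ∧ r (insert e S) = 2 ∧ r (insert f S) = 2 ∧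
      r Finset.univ = 2 := by omega
  obtain ⟨h1e, h1f, h1S, heS, hfS, hU⟩ := hfacts
  have hpair := hsep {e, f} (by
    have := hr.singleton_le_of_mem (show e ∈ ({e, f} : Finset (Fin n)) by simp)
    omega) (by rw [← hSdef]; omega)
  rw [← hSdef] at hpair
  obtain ⟨i, hiS, hi⟩ : ∃ i ∈ S, r {i} ≠ 0 := by
    by_contra hcon
    push Not at hcon
    have := hr.eq_of_forall_insert (Finset.empty_subset S) (fun i hi => by
      rw [hr.empty]; exact hcon i hi)
    rw [hr.empty] at this
    omega
  have bi := hr.singleton_le i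
  have hpari : ∀ j ∈ S, r (insert j {i}) = r {i} := by
    intro j hj
    have h1 := hr.le_insert j {i}
    have h2 := hr.mono (show insert j {i} ⊆ S from
      Finset.insert_subset hj (Finset.singleton_subset_iff.2 hiS))
    omega
  have hspan : ∀ x, r (insert x {i}) = r (insert x S) := by
    intro x
    refine (hr.eq_of_forall_insert (Finset.insert_subset_insert x
      (Finset.singleton_subset_iff.2 hiS)) fun j hj => ?_).symm
    rcases Finset.mem_insert.1 hj with rfl | hj
    · rw [Finset.insert_idem]
    · exact hr.insert_eq_of_subset (Finset.subset_insert x {i}) (hpari j hj)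
  have hiS' : i ≠ e ∧ i ≠ f := by
    simpa [hSdef] using hiS
  have hpu := hr.mono (Finset.subset_univ {e, f})
  refine ⟨i, hiS'.1, hiS'.2, hU, by omega, (hspan e).trans heS, (hspan f).trans hfS,
    fun j je jf ji => ?_⟩
  have hjS : j ∈ S := by simp [hSdef, je, jf]
  have := hpari j hjS
  have := hr.singleton_le j
  omega

/-- `j` and `k` are independent, but become parallel after the contraction of `Z`. -/
structure IsLinkedBy (r : Finset (Fin n) → ℕ) (j k : Fin n) (Z : Finset (Fin n)) : Prop where
  left : r {j} = 1
  right : r {k} = 1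
  pair : r {j, k} = 2
  insert_left : r (insert j Z) = r Z + 1
  insert_right : r (insert k Z) = r Z + 1
  insert_pair : r (insert j (insert k Z)) = r Z + 1

/-- The parallel class `P` of `j` outside `{e, f}` is not a separator, so its complement spans `j`.
Take a minimal `W` there spanning `j`. An element `k` of `W` outside `{e, f}` is linked to `j` by
the rest of `W`; if there is none, `{e, f}` spans `j`. -/
theorem exists_linked_or_spanned (hr : IsRankFunction r)
    (hsep : ∀ A, r A ≠ 0 → r Aᶜ ≠ 0 → r Finset.univ < r A + r Aᶜ) {j : Fin n}
    (hS : 2 ≤ r {e, f}ᶜ) (hjS : j ∉ ({e, f} : Finset (Fin n))) (hj : r {j} = 1) :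
    (∃ k Z, k ∉ ({e, f} : Finset (Fin n)) ∧ IsLinkedBy r j k Z) ∨
      r (insert j {e, f}) = r {e, f} := by
  set P : Finset (Fin n) := ({e, f}ᶜ : Finset (Fin n)).filter
    (fun x => r (insert x {j}) = 1) with hP
  have hPj : {j} ⊆ P := by
    rw [Finset.singleton_subset_iff, hP, Finset.mem_filter, Finset.mem_compl]
    exact ⟨hjS, by simpa using hj⟩
  have hrP : r P = 1 := by
    rw [hr.eq_of_forall_insert hPj fun x hx => ((Finset.mem_filter.1 hx).2.trans hj.symm), hj]
  obtain ⟨l, hl, hlj⟩ : ∃ l ∈ ({e, f}ᶜ : Finset (Fin n)), r (insert l {j}) ≠ r {j} := by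
    by_contra hcon
    push Not at hcon
    have := hr.eq_of_forall_insert (K := {j}) (L := {e, f}ᶜ)
      (Finset.singleton_subset_iff.2 (Finset.mem_compl.2 hjS)) hcon
    omega
  have hlP : l ∈ Pᶜ := by
    rw [Finset.mem_compl, hP, Finset.mem_filter]
    rintro ⟨-, h⟩
    exact hlj (h.trans hj.symm)
  have hspan : r (insert j Pᶜ) = r Pᶜ := by
    have h1 := hr.singleton_le_of_mem hlP
    have h2 : r (insert l {j}) ≤ r {l} + r {j} := by
      have := hr.submod {l} {j}
      rw [← Finset.insert_eq] at this
      omega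
    have h3 := hr.le_insert l {j}
    have h4 := hsep P (by omega) (by omega)
    have h5 := hr.mono (Finset.subset_univ (insert j Pᶜ))
    have h6 := hr.le_insert j Pᶜ
    omega
  obtain ⟨W, hW⟩ := (Finset.powerset Pᶜ |>.filter (fun W => r (insert j W) = r W)).exists_minimal
    ⟨Pᶜ, Finset.mem_filter.2 ⟨Finset.mem_powerset_self _, hspan⟩⟩
  obtain ⟨hWP, hWj⟩ := Finset.mem_filter.1 hW.prop
  rw [Finset.mem_powerset] at hWP
  by_cases hk : ∃ k ∈ W, k ∉ ({e, f} : Finset (Fin n))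
  · left
    obtain ⟨k, hkW, hkS⟩ := hk
    refine ⟨k, W.erase k, hkS, ?_⟩
    have hins : insert k (W.erase k) = W := Finset.insert_erase hkW
    have hZ : r (insert j (W.erase k)) ≠ r (W.erase k) := fun hh =>
      Finset.notMem_erase k W (hW.le_of_le (Finset.mem_filter.2 ⟨Finset.mem_powerset.2
        ((Finset.erase_subset k W).trans hWP), hh⟩) (Finset.erase_subset k W) hkW)
    have a1 := hr.le_insert j (W.erase k)
    have a2 := hr.insert_le j (W.erase k)
    have a3 := hr.insert_le k (W.erase k)
    have a4 := hr.mono (Finset.insert_subset_insert j (Finset.erase_subset k W))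
    rw [hins] at a3
    have hkj : r (insert k {j}) ≠ 1 := fun hh => Finset.mem_compl.1 (hWP hkW)
      (Finset.mem_filter.2 ⟨Finset.mem_compl.2 hkS, hh⟩)
    rw [Finset.pair_comm] at hkj
    have b1 := hr.insert_le j {k}
    have b2 := hr.singleton_le k
    have b3 := hr.singleton_le_of_mem (show j ∈ ({j, k} : Finset (Fin n)) by simp)
    refine ⟨hj, by omega, by omega, by omega, ?_, ?_⟩
    · rw [hins]; omega
    · rw [hins]; omega
  · right
    push Not at hk
    exact hr.insert_eq_of_subset hk hWj

/-- If no pair is linked, the previous dichotomy puts everything on the line through `e` and `f`.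
Two non-parallel elements `j`, `l` off `{e, f}` are linked by any third point of that line, so every
element is a loop or parallel to one of them. The rank-two matroid then has a separator. -/
theorem exists_linked (hr : IsRankFunction r)
    (hsep : ∀ A, r A ≠ 0 → r Aᶜ ≠ 0 → r Finset.univ < r A + r Aᶜ)
    (hu : 2 ≤ r Finset.univ) (hS : 2 ≤ r {e, f}ᶜ) :
    ∃ j k Z, j ∉ ({e, f} : Finset (Fin n)) ∧ k ∉ ({e, f} : Finset (Fin n)) ∧
      IsLinkedBy r j k Z := by
  by_contra hcon
  push Not at hcon
  have hspan : ∀ x ∈ Finset.univ, r (insert x {e, f}) = r {e, f} := by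
    intro x _
    by_cases hx : x ∈ ({e, f} : Finset (Fin n))
    · rw [Finset.insert_eq_of_mem hx]
    by_cases hx0 : r {x} = 0
    · exact hr.insert_eq_of_subset (Finset.empty_subset _) (by rw [hr.empty]; exact hx0)
    · have := hr.singleton_le x
      rcases exists_linked_or_spanned hr hsep hS hx (by omega) with ⟨k, Z, hk, hl⟩ | h
      · exact absurd hl (hcon x k Z hx hk)
      · exact h
  have hU := hr.eq_of_forall_insert (Finset.subset_univ {e, f}) hspan
  have hU2 : r Finset.univ = 2 := by
    have h1 := hr.insert_le e {f}
    have h2 := hr.singleton_le f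
    omega
  obtain ⟨j, hjS, hj⟩ : ∃ j ∈ ({e, f}ᶜ : Finset (Fin n)), r {j} ≠ 0 := by
    by_contra hcon
    push Not at hcon
    have := hr.eq_of_forall_insert (Finset.empty_subset {e, f}ᶜ) (fun i hi => by
      rw [hr.empty]; exact hcon i hi)
    rw [hr.empty] at this
    omega
  have hj1 := hr.singleton_le j
  obtain ⟨l, hlS, hl⟩ : ∃ l ∈ ({e, f}ᶜ : Finset (Fin n)), r (insert l {j}) ≠ r {j} := by
    by_contra hcon
    push Not at hcon
    have := hr.eq_of_forall_insert (K := {j}) (L := {e, f}ᶜ)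
      (Finset.singleton_subset_iff.2 hjS) hcon
    omega
  have hl1 := hr.singleton_le l
  have hlj := hr.le_insert l {j}
  have hlj' := hr.insert_le j {l}
  rw [Finset.pair_comm] at hlj'
  -- `x` may be `e` or `f`: only the linked elements, not `Z`, must avoid them.
  have key : ∀ x, r {x, j} = 1 ∨ r {x, l} = 1 := by
    intro x
    have x1 := hr.insert_le x {j}
    have x2 := hr.insert_le x {l}
    have x3 := hr.le_insert x {j}
    have x4 := hr.le_insert x {l}
    have x5 := hr.singleton_le x
    by_contra hx
    have x6 := hr.insert_le j {x}
    rw [Finset.pair_comm] at x6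
    have x7 := hr.mono (show ({x, j} : Finset (Fin n)) ⊆ insert j (insert l {x}) by
      intro y; simp; tauto)
    have x8 := hr.mono (Finset.subset_univ (insert j (insert l {x})))
    have e1 : r {j, l} = r {l, j} := by rw [Finset.pair_comm]
    have e2 : r {j, x} = r {x, j} := by rw [Finset.pair_comm]
    have e3 : r {l, x} = r {x, l} := by rw [Finset.pair_comm]
    exact hcon j l {x} (Finset.mem_compl.1 hjS) (Finset.mem_compl.1 hlS)
      ⟨by omega, by omega, by omega, by omega, by omega, by omega⟩
  set A : Finset (Fin n) := Finset.univ.filter (fun x => r {x, j} = 1) with hA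
  have hrA : r A = 1 := by
    rw [hr.eq_of_forall_insert (K := {j}) (L := A) ?_ fun x hx => ?_]
    · omega
    · rw [Finset.singleton_subset_iff, hA, Finset.mem_filter]
      refine ⟨Finset.mem_univ _, ?_⟩
      rw [Finset.pair_eq_singleton]; omega
    · rw [(Finset.mem_filter.1 hx).2]; omega
  have hlA : l ∈ Aᶜ := by
    rw [Finset.mem_compl, hA, Finset.mem_filter]
    rintro ⟨-, h⟩
    omega
  have hrA' : r Aᶜ = 1 := by
    rw [hr.eq_of_forall_insert (K := {l}) (L := Aᶜ) (Finset.singleton_subset_iff.2 hlA)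
      fun x hx => ?_]
    · omega
    · rcases key x with h | h
      · exact absurd (hA ▸ Finset.mem_filter.2 ⟨Finset.mem_univ x, h⟩ : x ∈ A)
          (Finset.mem_compl.1 hx)
      · rw [h]; omega
  have := hsep A (by omega) (by omega)
  omega

end Connected

/-! ### Entropy and the equality cases of Shannon's inequalities -/

section Law

variable {Ω α β γ : Type} [Fintype Ω]

open Classical in
/-- The mass function of the random variable `f` when `p` is that of the outcome. -/
noncomputable def law (p : Ω → ℝ) (f : Ω → α) (y : α) : ℝ :=
  ∑ ω, if f ω = y then p ω else 0

/-- Shannon entropy of the random variable `f`, as an expectation over the outcomes. -/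
noncomputable def ent (p : Ω → ℝ) (f : Ω → α) : ℝ :=
  -∑ ω, p ω * Real.log (law p f (f ω))

theorem sum_law_mul [Fintype α] (p : Ω → ℝ) (f : Ω → α) (c : α → ℝ) :
    ∑ y, law p f y * c y = ∑ ω, p ω * c (f ω) := by
  classical
  simp only [law, Finset.sum_mul, ite_mul, zero_mul]
  rw [Finset.sum_comm]
  simp

theorem ent_eq_sum_negMulLog [Fintype α] (p : Ω → ℝ) (f : Ω → α) :
    ent p f = ∑ y, Real.negMulLog (law p f y) := by
  simp only [ent, Real.negMulLog, neg_mul, Finset.sum_neg_distrib]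
  rw [sum_law_mul p f (fun y => Real.log (law p f y))]

theorem law_id (p : Ω → ℝ) : law p id = p := by
  classical
  ext y
  simp [law]

theorem law_congr {p : Ω → ℝ} {f : Ω → α} {g : Ω → β} {x : α} {y : β}
    (h : ∀ ω, p ω ≠ 0 → (f ω = x ↔ g ω = y)) : law p f x = law p g y := by
  classical
  unfold law
  refine Finset.sum_congr rfl fun ω _ => ?_
  by_cases h0 : p ω = 0
  · simp [h0]
  · simp only [h ω h0]

theorem ent_congr {p : Ω → ℝ} {f : Ω → α} {g : Ω → β}
    (h : ∀ ω ω', f ω = f ω' ↔ g ω = g ω') : ent p f = ent p g := by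
  unfold ent
  congr 1
  refine Finset.sum_congr rfl fun ω _ => ?_
  rw [law_congr fun ω' _ => h ω' ω]

theorem law_law [Fintype α] (p : Ω → ℝ) (f : Ω → α) (g : α → β) (y : β) :
    law (law p f) g y = law p (fun ω => g (f ω)) y := by
  classical
  have := sum_law_mul p f (fun x => if g x = y then 1 else 0)
  simpa [law] using this

theorem law_mem_stdSimplex [Fintype α] {p : Ω → ℝ} (hp : p ∈ stdSimplex ℝ Ω) (f : Ω → α) :
    law p f ∈ stdSimplex ℝ α := by
  refine ⟨fun y => Finset.sum_nonneg fun ω _ => ?_, ?_⟩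
  · split_ifs
    exacts [hp.1 ω, le_rfl]
  · have := sum_law_mul p f (fun _ => 1)
    simpa [hp.2] using this

theorem law_nonneg {p : Ω → ℝ} (hp : ∀ ω, 0 ≤ p ω) (f : Ω → α) (y : α) : 0 ≤ law p f y :=
  Finset.sum_nonneg fun ω _ => by
    split_ifs
    exacts [hp ω, le_rfl]

theorem le_law {p : Ω → ℝ} (hp : ∀ ω, 0 ≤ p ω) (f : Ω → α) (ω : Ω) : p ω ≤ law p f (f ω) := by
  classical
  have := Finset.single_le_sum (f := fun ω' => if f ω' = f ω then p ω' else 0)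
    (fun ω' _ => by split_ifs; exacts [hp ω', le_rfl]) (Finset.mem_univ ω)
  simp only [if_true] at this
  exact this.trans (le_of_eq (Finset.sum_congr rfl fun _ _ => by congr))

theorem exists_of_law_pos {p : Ω → ℝ} (hp : ∀ ω, 0 ≤ p ω) {f : Ω → α} {y : α}
    (h : 0 < law p f y) : ∃ ω, 0 < p ω ∧ f ω = y := by
  obtain ⟨ω, -, hω⟩ := Finset.exists_ne_zero_of_sum_ne_zero h.ne'
  by_cases hf : f ω = y
  · rw [if_pos hf] at hω
    exact ⟨ω, (hp ω).lt_of_ne hω.symm, hf⟩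
  · exact absurd (if_neg hf) hω

/-- `f` determines `g` on the support of `p`. -/
def Determines (p : Ω → ℝ) (f : Ω → α) (g : Ω → β) : Prop :=
  ∀ ω ω', 0 < p ω → 0 < p ω' → f ω = f ω' → g ω = g ω'

/-- `f` and `g` are independent. -/
def Independent (p : Ω → ℝ) (f : Ω → α) (g : Ω → β) : Prop :=
  ∀ x y, law p (fun ω => (f ω, g ω)) (x, y) = law p f x * law p g y

theorem law_pair_le {p : Ω → ℝ} (hp : ∀ ω, 0 ≤ p ω) (f : Ω → α) (g : Ω → β) (x : α) (y : β) :
    law p (fun ω => (f ω, g ω)) (x, y) ≤ law p f x := by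
  refine Finset.sum_le_sum fun ω _ => ?_
  simp only [Prod.mk.injEq]
  have := hp ω
  split_ifs <;> simp_all

/-- The conditional entropy is an average of nonnegative terms. If it vanishes, the joint and
marginal probabilities agree at every outcome of positive mass. -/
theorem determines_of_ent_eq {p : Ω → ℝ} (hp : ∀ ω, 0 ≤ p ω) {f : Ω → α} {g : Ω → β}
    (h : ent p (fun ω => (f ω, g ω)) = ent p f) : Determines p f g := by
  classical
  have hterm : ∀ ω ∈ Finset.univ, 0 ≤ p ω * (Real.log (law p f (f ω)) -
      Real.log (law p (fun ω => (f ω, g ω)) (f ω, g ω))) := by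
    intro ω _
    rcases (hp ω).eq_or_lt with h0 | hpos
    · rw [← h0, zero_mul]
    · refine mul_nonneg (hp ω) (sub_nonneg.2 (Real.log_le_log ?_ (law_pair_le hp f g _ _)))
      exact hpos.trans_le (le_law hp (fun ω => (f ω, g ω)) ω)
  have hsum : ∑ ω, p ω * (Real.log (law p f (f ω)) -
      Real.log (law p (fun ω => (f ω, g ω)) (f ω, g ω))) = 0 := by
    simp only [mul_sub, Finset.sum_sub_distrib]
    unfold ent at h
    linarith
  intro ω ω' hω hω' hf
  by_contra hg
  have h0 := (Finset.sum_eq_zero_iff_of_nonneg hterm).1 hsum ω (Finset.mem_univ _)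
  have hlog := (mul_eq_zero.1 h0).resolve_left hω.ne'
  have heq := Real.log_injOn_pos (hω.trans_le (le_law hp f ω))
    (hω.trans_le (le_law hp (fun ω => (f ω, g ω)) ω)) (sub_eq_zero.1 hlog)
  have hlt : law p (fun ω => (f ω, g ω)) (f ω, g ω) < law p f (f ω) := by
    refine Finset.sum_lt_sum (fun ω'' _ => ?_) ⟨ω', Finset.mem_univ _, ?_⟩
    · simp only [Prod.mk.injEq]
      have := hp ω''
      split_ifs <;> simp_all
    · simp only [Prod.mk.injEq]
      rw [if_neg (fun hh => hg hh.2.symm), if_pos hf.symm]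
      exact hω'
  exact hlt.ne heq.symm

theorem independent_of_ent_eq [Fintype α] [Fintype β] {p : Ω → ℝ} (hp : p ∈ stdSimplex ℝ Ω)
    {f : Ω → α} {g : Ω → β} (h : ent p (fun ω => (f ω, g ω)) = ent p f + ent p g) :
    Independent p f g := by
  set P := law p (fun ω => (f ω, g ω)) with hP
  have hPnn : ∀ z, 0 ≤ P z := law_nonneg hp.1 _
  have hf := law_mem_stdSimplex hp f
  have hg := law_mem_stdSimplex hp g
  have hfg := law_mem_stdSimplex hp (fun ω => (f ω, g ω))
  -- The summand of the mutual information, corrected by a term of total sum zero so that it becomes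
  -- nonnegative pointwise: a multiple of `klFun`.
  let D : α × β → ℝ := fun z => P z * (Real.log (P z) - (Real.log (law p f z.1) +
    Real.log (law p g z.2))) + law p f z.1 * law p g z.2 - P z
  have hPf : ∀ x y, P (x, y) ≤ law p f x := law_pair_le hp.1 f g
  have hPg : ∀ x y, P (x, y) ≤ law p g y := by
    intro x y
    have := law_pair_le hp.1 g f y x
    rwa [law_congr (g := fun ω => (f ω, g ω)) (y := (x, y))
      (fun ω _ => by simp only [Prod.mk.injEq]; tauto)] at this
  have hDkl : ∀ z, 0 < law p f z.1 → 0 < law p g z.2 →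
      D z = law p f z.1 * law p g z.2 *
        InformationTheory.klFun (P z / (law p f z.1 * law p g z.2)) := by
    intro z h1 h2
    have h12 := mul_pos h1 h2
    rcases (hPnn z).eq_or_lt with h0 | h0
    · simp [D, ← h0, InformationTheory.klFun_zero]
    · simp only [D, InformationTheory.klFun_apply]
      rw [Real.log_div h0.ne' h12.ne', Real.log_mul h1.ne' h2.ne']
      field_simp
  have hzero : ∀ z, ¬ (0 < law p f z.1 ∧ 0 < law p g z.2) →
      P z = 0 ∧ law p f z.1 * law p g z.2 = 0 := by
    intro z hz
    have h1 := hf.1 z.1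
    have h2 := hg.1 z.2
    have h3 := hPf z.1 z.2
    have h4 := hPg z.1 z.2
    have h5 := hPnn z
    rcases h1.eq_or_lt with h1 | h1
    · exact ⟨le_antisymm (h1 ▸ h3) h5, by rw [← h1, zero_mul]⟩
    · have : law p g z.2 = 0 := le_antisymm (not_lt.1 fun hh => hz ⟨h1, hh⟩) h2
      exact ⟨le_antisymm (this ▸ h4) h5, by rw [this, mul_zero]⟩
  have hDnn : ∀ z ∈ Finset.univ, 0 ≤ D z := by
    intro z _
    by_cases hz : 0 < law p f z.1 ∧ 0 < law p g z.2
    · rw [hDkl z hz.1 hz.2]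
      have := mul_pos hz.1 hz.2
      exact mul_nonneg this.le (InformationTheory.klFun_nonneg (div_nonneg (hPnn z) this.le))
    · obtain ⟨h1, h2⟩ := hzero z hz
      simp [D, h1, h2]
  have hDsum : ∑ z, D z = 0 := by
    have e1 : ∑ z : α × β, law p f z.1 * law p g z.2 = 1 := by
      rw [Fintype.sum_prod_type]
      simp only [← Finset.mul_sum, hg.2, mul_one, hf.2]
    have e2 := sum_law_mul p (fun ω => (f ω, g ω)) (fun z => Real.log (P z) -
      (Real.log (law p f z.1) + Real.log (law p g z.2)))
    simp only [D, Finset.sum_add_distrib, Finset.sum_sub_distrib, e1]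
    rw [← hP] at e2 hfg
    rw [e2, hfg.2]
    simp only [mul_sub, mul_add, Finset.sum_add_distrib, Finset.sum_sub_distrib]
    unfold ent at h
    linarith
  intro x y
  by_cases hz : 0 < law p f x ∧ 0 < law p g y
  · have h0 := (Finset.sum_eq_zero_iff_of_nonneg hDnn).1 hDsum (x, y) (Finset.mem_univ _)
    have h12 := mul_pos hz.1 hz.2
    rw [hDkl (x, y) hz.1 hz.2] at h0
    have h1 := (InformationTheory.klFun_eq_zero_iff (div_nonneg (hPnn (x, y)) h12.le)).1
      ((mul_eq_zero.1 h0).resolve_left h12.ne')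
    exact (div_eq_one_iff_eq h12.ne').1 h1
  · obtain ⟨h1, h2⟩ := hzero (x, y) hz
    exact h1.trans h2.symm

/-- Two variables, independent of `g` and determining each other given `g`, have equal
probabilities at simultaneous values. -/
theorem law_eq_law {p : Ω → ℝ} (hp : ∀ ω, 0 ≤ p ω) {f : Ω → α} {k : Ω → β} {g : Ω → γ}
    (hfg : Independent p f g) (hkg : Independent p k g)
    (h1 : Determines p (fun ω => (f ω, g ω)) k) (h2 : Determines p (fun ω => (k ω, g ω)) f)
    {ω : Ω} (hω : 0 < p ω) : law p f (f ω) = law p k (k ω) := by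
  have hg : 0 < law p g (g ω) := hω.trans_le (le_law hp g ω)
  refine mul_right_cancel₀ hg.ne' ?_
  rw [← hfg, ← hkg]
  refine law_congr fun ω' h0 => ?_
  have hω' := (hp ω').lt_of_ne (Ne.symm h0)
  simp only [Prod.mk.injEq]
  refine ⟨fun h => ⟨h1 ω' ω hω' hω (by simp [h.1, h.2]), h.2⟩,
    fun h => ⟨h2 ω' ω hω' hω (by simp [h.1, h.2]), h.2⟩⟩

theorem log_le_ent {p : Ω → ℝ} (hp : p ∈ stdSimplex ℝ Ω) {f : Ω → α} {m : ℝ} (hm : 0 < m)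
    (h : ∀ ω, 0 < p ω → m * law p f (f ω) ≤ 1) : Real.log m ≤ ent p f := by
  have h1 : ∑ ω, p ω * Real.log (law p f (f ω)) ≤ ∑ ω, p ω * (-Real.log m) := by
    refine Finset.sum_le_sum fun ω _ => ?_
    rcases (hp.1 ω).eq_or_lt with h0 | h0
    · rw [← h0, zero_mul, zero_mul]
    · refine mul_le_mul_of_nonneg_left ?_ h0.le
      have hl := h0.trans_le (le_law hp.1 f ω)
      have := Real.log_nonpos (by positivity) (h ω h0)
      rw [Real.log_mul hm.ne' hl.ne'] at this
      linarith
  rw [← Finset.sum_mul, hp.2] at h1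
  unfold ent
  linarith

open Classical in
theorem ent_le_log_card [Fintype α] {p : Ω → ℝ} (hp : p ∈ stdSimplex ℝ Ω) (f : Ω → α) :
    ent p f ≤ Real.log (Finset.univ.filter (fun y => 0 < law p f y)).card := by
  set T := Finset.univ.filter (fun y => 0 < law p f y) with hT
  have hl := law_mem_stdSimplex hp f
  have hTsum : ∑ y ∈ T, law p f y = 1 := by
    rw [← hl.2, hT, Finset.sum_filter_of_ne]
    exact fun y _ h0 => (hl.1 y).lt_of_ne (Ne.symm h0)
  have hTpos : 0 < (T.card : ℝ) := by
    rcases T.eq_empty_or_nonempty with h | h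
    · rw [h, Finset.sum_empty] at hTsum; norm_num at hTsum
    · exact_mod_cast h.card_pos
  have hent : ent p f = ∑ y ∈ T, Real.negMulLog (law p f y) := by
    rw [ent_eq_sum_negMulLog, hT, Finset.sum_filter_of_ne]
    intro y _ h0
    refine (hl.1 y).lt_of_ne fun hh => h0 ?_
    rw [← hh, Real.negMulLog_zero]
  -- The inequality `log x ≤ x - 1` at the reciprocal of `T.card * law p f y`; the corrections sum
  -- to zero over `T`.
  have hle : ∀ y ∈ T, Real.negMulLog (law p f y) ≤
      law p f y * Real.log T.card + ((T.card : ℝ)⁻¹ - law p f y) := by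
    intro y hy
    have hy0 : 0 < law p f y := (Finset.mem_filter.1 hy).2
    have := Real.log_le_sub_one_of_pos (show 0 < ((T.card : ℝ) * law p f y)⁻¹ by positivity)
    rw [Real.log_inv, Real.log_mul hTpos.ne' hy0.ne'] at this
    have h2 := mul_le_mul_of_nonneg_left this hy0.le
    have h3 : law p f y * ((T.card * law p f y)⁻¹ - 1) = (T.card : ℝ)⁻¹ - law p f y := by
      field_simp
    rw [h3] at h2
    simp only [Real.negMulLog]
    linarith
  rw [hent]
  refine (Finset.sum_le_sum hle).trans (le_of_eq ?_)
  rw [Finset.sum_add_distrib, Finset.sum_sub_distrib, ← Finset.sum_mul, hTsum, Finset.sum_const,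
    nsmul_eq_mul, mul_inv_cancel₀ hTpos.ne']
  ring

/-- A variable that is part of a `U_{2,3}`-like triple with two exact relations is uniform. -/
theorem exists_ent_eq_log [Fintype α] {p : Ω → ℝ} (hp : p ∈ stdSimplex ℝ Ω) {f : Ω → α}
    {k : Ω → β} {g : Ω → γ} (hfk : Independent p f k) (hfg : Independent p f g)
    (hkg : Independent p k g) (h1 : Determines p (fun ω => (f ω, g ω)) k)
    (h2 : Determines p (fun ω => (k ω, g ω)) f) : ∃ v : ℕ, 0 < v ∧ ent p f = Real.log v := by
  classical
  obtain ⟨ω₀, hω₀⟩ : ∃ ω, 0 < p ω := by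
    by_contra hcon
    push Not at hcon
    have := Finset.sum_nonpos (s := Finset.univ) (fun ω _ => hcon ω)
    rw [hp.2] at this
    norm_num at this
  -- By independence every value of `f` occurs together with the fixed value `k ω₀`, and there
  -- `law_eq_law` applies.
  have hconst : ∀ ω, 0 < p ω → law p f (f ω) = law p k (k ω₀) := by
    intro ω hω
    have hpos : 0 < law p (fun ω => (f ω, k ω)) (f ω, k ω₀) := by
      rw [hfk]
      exact mul_pos (hω.trans_le (le_law hp.1 f ω)) (hω₀.trans_le (le_law hp.1 k ω₀))
    obtain ⟨ω', hω', heq⟩ := exists_of_law_pos hp.1 hpos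
    rw [Prod.mk.injEq] at heq
    rw [← heq.1, ← heq.2]
    exact law_eq_law hp.1 hfg hkg h1 h2 hω'
  set T := Finset.univ.filter (fun y => 0 < law p f y) with hT
  have hl := law_mem_stdSimplex hp f
  have hTsum : ∑ y ∈ T, law p f y = 1 := by
    rw [← hl.2, hT, Finset.sum_filter_of_ne]
    exact fun y _ h0 => (hl.1 y).lt_of_ne (Ne.symm h0)
  have hcard : (T.card : ℝ) * law p k (k ω₀) = 1 := by
    rw [← hTsum, ← nsmul_eq_mul, ← Finset.sum_const]
    refine Finset.sum_congr rfl fun y hy => ?_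
    obtain ⟨ω, hω, rfl⟩ := exists_of_law_pos hp.1 (Finset.mem_filter.1 hy).2
    exact (hconst ω hω).symm
  have hTpos : 0 < T.card := by
    rw [Nat.pos_iff_ne_zero]
    intro h0
    rw [h0] at hcard
    norm_num at hcard
  refine ⟨T.card, hTpos, le_antisymm (ent_le_log_card hp f)
    (log_le_ent hp (by exact_mod_cast hTpos) fun ω hω => ?_)⟩
  rw [hconst ω hω, hcard]

/-- The quantitative relation behind the Matúš-type faces. -/
theorem log_ceil_exp_le_ent [Fintype α] [Fintype β] [Fintype γ] {p : Ω → ℝ}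
    (hp : p ∈ stdSimplex ℝ Ω) {f : Ω → α} {k : Ω → β} {g : Ω → γ} (hfg : Independent p f g)
    (hkg : Independent p k g) (h1 : Determines p (fun ω => (f ω, g ω)) k)
    (h2 : Determines p (fun ω => (k ω, g ω)) f) (h3 : Determines p (fun ω => (f ω, k ω)) g) :
    Real.log (⌈Real.exp (ent p g)⌉ : ℝ) ≤ ent p f := by
  classical
  set T := Finset.univ.filter (fun z => 0 < law p g z) with hT
  have hle : ent p g ≤ Real.log T.card := ent_le_log_card hp g
  have hl := law_mem_stdSimplex hp g
  have hTpos : 0 < (T.card : ℝ) := by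
    rcases T.eq_empty_or_nonempty with h | h
    · exfalso
      have h0 : ∀ z, law p g z ≤ 0 := fun z => not_lt.1 fun hh =>
        Finset.notMem_empty z (h ▸ Finset.mem_filter.2 ⟨Finset.mem_univ z, hh⟩)
      have := Finset.sum_nonpos (s := Finset.univ) (fun z _ => h0 z)
      rw [hl.2] at this
      norm_num at this
    · exact_mod_cast h.card_pos
  -- The support size is an integer at least `exp (ent p g)`; this is where the ceiling comes from.
  have hceil : (⌈Real.exp (ent p g)⌉ : ℝ) ≤ T.card := by
    have : ⌈Real.exp (ent p g)⌉ ≤ (T.card : ℤ) := by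
      rw [Int.ceil_le]
      have := Real.exp_le_exp.2 hle
      rwa [Real.exp_log hTpos] at this
    exact_mod_cast this
  have hceilpos : (0 : ℝ) < ⌈Real.exp (ent p g)⌉ := by
    exact_mod_cast Int.ceil_pos.2 (Real.exp_pos _)
  refine (Real.log_le_log hceilpos hceil).trans (log_le_ent hp hTpos fun ω hω => ?_)
  have hex : ∀ z ∈ T, ∃ ω', 0 < p ω' ∧ f ω' = f ω ∧ g ω' = z := by
    intro z hz
    have hpos : 0 < law p (fun ω => (f ω, g ω)) (f ω, z) := by
      rw [hfg]
      exact mul_pos (hω.trans_le (le_law hp.1 f ω)) (Finset.mem_filter.1 hz).2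
    obtain ⟨ω', hω', heq⟩ := exists_of_law_pos hp.1 hpos
    rw [Prod.mk.injEq] at heq
    exact ⟨ω', hω', heq⟩
  have : Nonempty Ω := ⟨ω⟩
  choose! w hw0 hwf hwg using hex
  have hinj : Set.InjOn (fun z => k (w z)) T := by
    intro z hz z' hz' hkk
    rw [← hwg z hz, ← hwg z' hz']
    exact h3 _ _ (hw0 z hz) (hw0 z' hz') (by
      rw [Prod.mk.injEq]; exact ⟨(hwf z hz).trans (hwf z' hz').symm, hkk⟩)
  have hk := law_mem_stdSimplex hp k
  -- A fixed value of `f` meets each of the `T.card` values of `g`. The resulting values of `k` are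
  -- distinct and each has the probability of that value of `f`.
  calc (T.card : ℝ) * law p f (f ω) = ∑ z ∈ T, law p k (k (w z)) := by
        rw [← nsmul_eq_mul, ← Finset.sum_const]
        refine Finset.sum_congr rfl fun z hz => ?_
        rw [← hwf z hz]
        exact law_eq_law hp.1 hfg hkg h1 h2 (hw0 z hz)
    _ = ∑ y ∈ T.image (fun z => k (w z)), law p k y := (Finset.sum_image hinj).symm
    _ ≤ ∑ y, law p k y := Finset.sum_le_sum_of_subset_of_nonneg (Finset.subset_univ _)
        fun y _ _ => hk.1 y
    _ = 1 := hk.2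

end Law

/-! ### Random vectors and the entropy region -/

section Vector

variable {Ω Ω' α β γ : Type}

/-- The subvector `X_A`. -/
def subvector {𝒳 : Fin n → Type} (X : ∀ i, Ω → 𝒳 i) (A : Finset (Fin n)) (ω : Ω) :
    ∀ i : A, 𝒳 i := A.restrict fun i => X i ω

theorem subvector_eq_iff {𝒳 : Fin n → Type} {X : ∀ i, Ω → 𝒳 i} {A : Finset (Fin n)} {ω ω' : Ω} :
    subvector X A ω = subvector X A ω' ↔ ∀ i ∈ A, X i ω = X i ω' := by
  simp [subvector, funext_iff]

variable [Fintype Ω] [Fintype Ω']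

theorem entropyFunction_law {𝒳 : Fin n → Type} [∀ i, Fintype (𝒳 i)] (p : Ω → ℝ)
    (X : ∀ i, Ω → 𝒳 i) (A : Finset (Fin n)) :
    entropyFunction (law p fun ω i => X i ω) A = ent p (subvector X A) := by
  classical
  rw [ent_eq_sum_negMulLog]
  unfold entropyFunction
  refine Finset.sum_congr (by congr) fun y _ => ?_
  congr 1
  trans law (law p fun ω i => X i ω) A.restrict y
  · unfold marginal law
    refine Finset.sum_congr (by congr) fun x _ => ?_
    split_ifs <;> rfl
  · rw [law_law]; rfl

/-- Any finite sample space may carry the vector, which lets constructions use products and shared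
sources of randomness. -/
theorem mem_entropyRegion_iff {h : EntropySpace n} :
    h ∈ entropyRegion n ↔ ∃ (Ω : Type) (_ : Fintype Ω) (𝒳 : Fin n → Type) (_ : ∀ i, Fintype (𝒳 i))
      (X : ∀ i, Ω → 𝒳 i), ∃ p ∈ stdSimplex ℝ Ω, ∀ A, h A = ent p (subvector X A) := by
  constructor
  · rintro ⟨𝒳, _, p, hp, rfl⟩
    refine ⟨∀ i, 𝒳 i, inferInstance, 𝒳, inferInstance, fun i x => x i, p, hp, fun A => ?_⟩
    rw [← entropyFunction_law]
    congr 1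
    exact (law_id p).symm
  · rintro ⟨Ω, _, 𝒳, _, X, p, hp, hA⟩
    refine ⟨𝒳, inferInstance, law p fun ω i => X i ω, law_mem_stdSimplex hp _, ?_⟩
    ext A
    rw [hA, entropyFunction_law]

theorem ent_subvector_pair {𝒳 : Fin n → Type} (X : ∀ i, Ω → 𝒳 i) (p : Ω → ℝ)
    (A B : Finset (Fin n)) :
    ent p (fun ω => (subvector X A ω, subvector X B ω)) = ent p (subvector X (A ∪ B)) := by
  refine ent_congr fun ω ω' => ?_
  simp only [Prod.mk.injEq, subvector_eq_iff, Finset.mem_union, or_imp, forall_and]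

theorem ent_subvector_triple {𝒳 : Fin n → Type} (X : ∀ i, Ω → 𝒳 i) (p : Ω → ℝ)
    (A B C : Finset (Fin n)) :
    ent p (fun ω => ((subvector X A ω, subvector X B ω), subvector X C ω)) =
      ent p (subvector X (A ∪ B ∪ C)) := by
  refine ent_congr fun ω ω' => ?_
  simp only [Prod.mk.injEq, subvector_eq_iff, Finset.mem_union, or_imp, forall_and]

theorem independent_subvector {𝒳 : Fin n → Type} [∀ i, Fintype (𝒳 i)] {X : ∀ i, Ω → 𝒳 i}
    {p : Ω → ℝ} (hp : p ∈ stdSimplex ℝ Ω) {h : EntropySpace n}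
    (hA : ∀ A, h A = ent p (subvector X A)) {A B : Finset (Fin n)} (hAB : h (A ∪ B) = h A + h B) :
    Independent p (subvector X A) (subvector X B) := by
  classical
  apply independent_of_ent_eq hp
  rw [ent_subvector_pair, ← hA, ← hA, ← hA, hAB]

theorem determines_subvector {𝒳 : Fin n → Type} {X : ∀ i, Ω → 𝒳 i}
    {p : Ω → ℝ} (hp : p ∈ stdSimplex ℝ Ω) {h : EntropySpace n}
    (hA : ∀ A, h A = ent p (subvector X A)) {A B C : Finset (Fin n)}
    (hAB : h (A ∪ B ∪ C) = h (A ∪ B)) :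
    Determines p (fun ω => (subvector X A ω, subvector X B ω)) (subvector X C) := by
  apply determines_of_ent_eq hp.1
  rw [ent_subvector_pair, ent_subvector_triple, ← hA, ← hA, hAB]

theorem exists_eq_log_of_mem_entropyRegion {h : EntropySpace n} (hh : h ∈ entropyRegion n)
    {A B C : Finset (Fin n)} (hAB : h (A ∪ B) = h A + h B) (hAC : h (A ∪ C) = h A + h C)
    (hBC : h (B ∪ C) = h B + h C) (h1 : h (A ∪ C ∪ B) = h (A ∪ C))
    (h2 : h (B ∪ C ∪ A) = h (B ∪ C)) : ∃ v : ℕ, 0 < v ∧ h A = Real.log v := by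
  classical
  obtain ⟨Ω, _, 𝒳, _, X, p, hp, hX⟩ := mem_entropyRegion_iff.1 hh
  rw [hX A]
  exact exists_ent_eq_log hp (independent_subvector hp hX hAB) (independent_subvector hp hX hAC)
    (independent_subvector hp hX hBC) (determines_subvector hp hX h1)
    (determines_subvector hp hX h2)

theorem log_ceil_exp_le_of_mem_entropyRegion {h : EntropySpace n} (hh : h ∈ entropyRegion n)
    {A B C : Finset (Fin n)} (hAC : h (A ∪ C) = h A + h C)
    (hBC : h (B ∪ C) = h B + h C) (h1 : h (A ∪ C ∪ B) = h (A ∪ C))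
    (h2 : h (B ∪ C ∪ A) = h (B ∪ C)) (h3 : h (A ∪ B ∪ C) = h (A ∪ B)) :
    Real.log (⌈Real.exp (h C)⌉ : ℝ) ≤ h A := by
  classical
  obtain ⟨Ω, _, 𝒳, _, X, p, hp, hX⟩ := mem_entropyRegion_iff.1 hh
  rw [hX A, hX C]
  exact log_ceil_exp_le_ent hp (independent_subvector hp hX hAC) (independent_subvector hp hX hBC)
    (determines_subvector hp hX h1) (determines_subvector hp hX h2)
    (determines_subvector hp hX h3)

theorem prod_mem_stdSimplex {p : Ω → ℝ} {q : Ω' → ℝ} (hp : p ∈ stdSimplex ℝ Ω)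
    (hq : q ∈ stdSimplex ℝ Ω') : (fun ω : Ω × Ω' => p ω.1 * q ω.2) ∈ stdSimplex ℝ (Ω × Ω') := by
  refine ⟨fun ω => mul_nonneg (hp.1 _) (hq.1 _), ?_⟩
  rw [Fintype.sum_prod_type]
  simp only [← Finset.mul_sum, hq.2, mul_one, hp.2]

theorem law_prod {p : Ω → ℝ} {q : Ω' → ℝ} {F : Ω × Ω' → γ} {f : Ω → α} {g : Ω' → β} {z : γ}
    {x : α} {y : β} (h : ∀ ω, F ω = z ↔ f ω.1 = x ∧ g ω.2 = y) :
    law (fun ω : Ω × Ω' => p ω.1 * q ω.2) F z = law p f x * law q g y := by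
  classical
  simp only [law, h]
  rw [Fintype.sum_prod_type, Finset.sum_mul_sum]
  refine Finset.sum_congr rfl fun ω _ => Finset.sum_congr rfl fun ω' _ => ?_
  by_cases h1 : f ω = x <;> by_cases h2 : g ω' = y <;> simp [h1, h2]

/-- The hypothesis only says that the fibres of `F` are products of fibres, so `F` need not be a
pair; `law_prod` then factors the probabilities. -/
theorem ent_prod {p : Ω → ℝ} {q : Ω' → ℝ} (hp : p ∈ stdSimplex ℝ Ω)
    (hq : q ∈ stdSimplex ℝ Ω') {F : Ω × Ω' → γ} {f : Ω → α} {g : Ω' → β}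
    (h : ∀ ω ω', F ω = F ω' ↔ f ω.1 = f ω'.1 ∧ g ω.2 = g ω'.2) :
    ent (fun ω : Ω × Ω' => p ω.1 * q ω.2) F = ent p f + ent q g := by
  have hterm : ∀ ω : Ω × Ω', p ω.1 * q ω.2 *
      Real.log (law (fun ω : Ω × Ω' => p ω.1 * q ω.2) F (F ω)) =
      p ω.1 * Real.log (law p f (f ω.1)) * q ω.2 +
        p ω.1 * (q ω.2 * Real.log (law q g (g ω.2))) := by
    intro ω
    rw [law_prod (fun ω' => h ω' ω)]
    rcases (hp.1 ω.1).eq_or_lt with h1 | h1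
    · simp [← h1]
    rcases (hq.1 ω.2).eq_or_lt with h2 | h2
    · simp [← h2]
    rw [Real.log_mul (h1.trans_le (le_law hp.1 f ω.1)).ne' (h2.trans_le (le_law hq.1 g ω.2)).ne']
    ring
  unfold ent
  rw [Finset.sum_congr rfl fun ω _ => hterm ω, Finset.sum_add_distrib, Fintype.sum_prod_type,
    Fintype.sum_prod_type]
  simp only [← Finset.mul_sum, ← Finset.sum_mul, hp.2, hq.2, mul_one, one_mul]
  ring

theorem ent_of_forall_eq {p : Ω → ℝ} (hp : p ∈ stdSimplex ℝ Ω) {f : Ω → α}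
    (h : ∀ ω ω', f ω = f ω') : ent p f = 0 := by
  have : ∀ ω, law p f (f ω) = 1 := fun ω => by
    unfold law
    rw [← hp.2]
    exact Finset.sum_congr rfl fun ω' _ => if_pos (h ω' ω)
  simp [ent, this]

theorem ent_id (p : Ω → ℝ) : ent p id = ∑ ω, Real.negMulLog (p ω) := by
  rw [ent_eq_sum_negMulLog, law_id]

/-- Pair two independent vectors coordinatewise. -/
theorem add_mem_entropyRegion {h g : EntropySpace n} (hh : h ∈ entropyRegion n)
    (hg : g ∈ entropyRegion n) : h + g ∈ entropyRegion n := by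
  obtain ⟨Ω, _, 𝒳, _, X, p, hp, hX⟩ := mem_entropyRegion_iff.1 hh
  obtain ⟨Ω', _, 𝒴, _, Y, q, hq, hY⟩ := mem_entropyRegion_iff.1 hg
  refine mem_entropyRegion_iff.2 ⟨Ω × Ω', inferInstance, fun i => 𝒳 i × 𝒴 i, inferInstance,
    fun i ω => (X i ω.1, Y i ω.2), _, prod_mem_stdSimplex hp hq, fun A => ?_⟩
  rw [Pi.add_apply, hX, hY, eq_comm]
  refine ent_prod hp hq fun ω ω' => ?_
  simp only [subvector_eq_iff, Prod.mk.injEq]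
  exact ⟨fun h => ⟨fun i hi => (h i hi).1, fun i hi => (h i hi).2⟩,
    fun h i hi => ⟨h.1 i hi, h.2 i hi⟩⟩

theorem uniform_mem_stdSimplex (m : ℕ) :
    (fun _ => ((m : ℝ) + 1)⁻¹) ∈ stdSimplex ℝ (Fin (m + 1)) := by
  refine ⟨fun _ => by positivity, ?_⟩
  rw [Finset.sum_const, Finset.card_univ, Fintype.card_fin, nsmul_eq_mul]
  push_cast
  exact mul_inv_cancel₀ (by positivity)

theorem sum_negMulLog_uniform (m : ℕ) :
    ∑ _ : Fin (m + 1), Real.negMulLog ((m : ℝ) + 1)⁻¹ = Real.log (m + 1) := by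
  rw [Finset.sum_const, Finset.card_univ, Fintype.card_fin, nsmul_eq_mul, Real.negMulLog,
    Real.log_inv]
  push_cast
  field_simp

/-- Entropy is continuous on the connected simplex and runs from `0` at a point mass to `log (m +
1)` at the uniform distribution. -/
theorem exists_sum_negMulLog_eq (m : ℕ) {a : ℝ} (ha : 0 ≤ a) (ham : a ≤ Real.log (m + 1)) :
    ∃ s ∈ stdSimplex ℝ (Fin (m + 1)), ∑ i, Real.negMulLog (s i) = a := by
  have hc : ContinuousOn (fun s : Fin (m + 1) → ℝ => ∑ i, Real.negMulLog (s i))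
      (stdSimplex ℝ (Fin (m + 1))) := by
    apply Continuous.continuousOn
    fun_prop
  have hmem := (convex_stdSimplex ℝ (Fin (m + 1))).isPreconnected.intermediate_value
    (single_mem_stdSimplex ℝ (0 : Fin (m + 1))) (uniform_mem_stdSimplex m) hc
  have h0 : ∑ i, Real.negMulLog ((Pi.single (0 : Fin (m + 1)) (1 : ℝ) : Fin (m + 1) → ℝ) i) = 0 :=
    Finset.sum_eq_zero fun i _ => by
      by_cases hi : i = 0
      · subst hi; simp
      · simp [hi]
  rw [h0, sum_negMulLog_uniform] at hmem
  obtain ⟨s, hs, hsa⟩ := hmem ⟨ha, ham⟩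
  exact ⟨s, hs, hsa⟩

/-- Place one variable of entropy `b` at both `e` and `f` and constants elsewhere; the alphabet has
more than `exp b` letters. -/
theorem smul_pairRank_mem_entropyRegion (e f : Fin n) {b : ℝ} (hb : 0 ≤ b) :
    b • pairRank e f ∈ entropyRegion n := by
  obtain ⟨m, hm⟩ := exists_nat_ge (Real.exp b)
  obtain ⟨s, hs, hsb⟩ := exists_sum_negMulLog_eq m hb (by
    rw [← Real.log_exp b]
    exact Real.log_le_log (Real.exp_pos b) (by linarith))
  refine mem_entropyRegion_iff.2 ⟨Fin (m + 1), inferInstance, fun _ => Fin (m + 1), inferInstance,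
    fun i ω => if i = e ∨ i = f then ω else 0, s, hs, fun A => ?_⟩
  simp only [Pi.smul_apply, pairRank, smul_eq_mul]
  split_ifs with hA
  · rw [mul_one, ← hsb, ← ent_id]
    refine ent_congr fun ω ω' => ?_
    rw [subvector_eq_iff]
    refine ⟨fun h i _ => by simp only [id] at h; rw [h], fun h => ?_⟩
    rcases hA with hA | hA
    · simpa using h e hA
    · simpa using h f hA
  · rw [mul_zero, ent_of_forall_eq hs fun ω ω' => ?_]
    rw [subvector_eq_iff]
    intro i hi
    rw [if_neg, if_neg]
    all_goals
      rintro (rfl | rfl)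
      · exact hA (Or.inl hi)
      · exact hA (Or.inr hi)

end Vector

/-! ### Entropic points in the exceptional case -/

theorem IsExceptionalRank.parallel {r : Finset (Fin n) → ℕ} (hr : IsRankFunction r)
    {e f i : Fin n} (hx : IsExceptionalRank r e f i) {j : Fin n} (je : j ≠ e) (jf : j ≠ f)
    (hj : r {j} ≠ 0) : r {j} = 1 ∧ r {j, i} = 1 := by
  by_cases ji : j = i
  · subst ji
    have := hr.singleton_le j
    rw [Finset.pair_eq_singleton]
    omega
  · exact (hx.other j je jf ji).resolve_left hj

theorem IsExceptionalRank.symm {r : Finset (Fin n) → ℕ} {e f i : Fin n}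
    (hx : IsExceptionalRank r e f i) : IsExceptionalRank r f e i :=
  ⟨hx.ne_right, hx.ne_left, hx.univ, Finset.pair_comm e f ▸ hx.pair, hx.right, hx.left,
    fun j je jf ji => hx.other j jf je ji⟩

/-- The non-loops form three parallel classes, those of `e`, `f` and `i`, and any two of them span.
-/
theorem IsExceptionalRank.rank_of_left {r : Finset (Fin n) → ℕ} (hr : IsRankFunction r)
    {e f i : Fin n} (hx : IsExceptionalRank r e f i) {A : Finset (Fin n)} (he : e ∈ A) :
    r A = if f ∈ A ∨ ∃ j ∈ A, j ≠ e ∧ j ≠ f ∧ r {j} ≠ 0 then 2 else 1 := by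
  have hle := hr.mono (Finset.subset_univ A)
  rw [hx.univ] at hle
  have h1 := hr.insert_le i {e}
  have h2 := hr.singleton_le e
  have h3 := hx.left
  rw [Finset.pair_comm] at h3
  split_ifs with h
  · refine le_antisymm hle ?_
    rcases h with h | ⟨j, hjA, je, jf, hj⟩
    · rw [← hx.pair]
      exact hr.mono (Finset.insert_subset he (Finset.singleton_subset_iff.2 h))
    · obtain ⟨p1, p2⟩ := hx.parallel hr je jf hj
      have hcl : r (insert i {j}) = r {j} := by
        rw [p1, ← p2, Finset.pair_comm]
      have := hr.insert_eq_of_subset (Finset.singleton_subset_iff.2 hjA) hcl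
      rw [← this, ← hx.left]
      exact hr.mono (Finset.insert_subset (Finset.mem_insert_of_mem he)
        (Finset.singleton_subset_iff.2 (Finset.mem_insert_self _ _)))
  · push Not at h
    rw [hr.eq_of_forall_insert (Finset.singleton_subset_iff.2 he) fun x hxA => ?_]
    · omega
    · by_cases hxe : x = e
      · subst hxe; rw [Finset.insert_eq_of_mem (Finset.mem_singleton_self _)]
      · refine hr.insert_eq_of_subset (Finset.empty_subset _) ?_
        rw [hr.empty]
        exact h.2 x hxA hxe (fun hf => h.1 (hf ▸ hxA))

theorem IsExceptionalRank.rank_of_not_mem {r : Finset (Fin n) → ℕ} (hr : IsRankFunction r)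
    {e f i : Fin n} (hx : IsExceptionalRank r e f i) {A : Finset (Fin n)} (he : e ∉ A)
    (hf : f ∉ A) : r A = if ∃ j ∈ A, j ≠ e ∧ j ≠ f ∧ r {j} ≠ 0 then 1 else 0 := by
  split_ifs with h
  · obtain ⟨j, hjA, je, jf, hj⟩ := h
    have hi1 : r {i} = 1 := by
      have := hr.insert_le e {i}
      have := hr.singleton_le i
      have := hx.left
      omega
    have hup : r (insert i A) = 1 := by
      rw [hr.eq_of_forall_insert (K := {i}) (by simp) fun x hxA => ?_, hi1]
      rcases Finset.mem_insert.1 hxA with rfl | hxA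
      · rw [Finset.insert_eq_of_mem (Finset.mem_singleton_self _)]
      by_cases hx0 : r {x} = 0
      · exact hr.insert_eq_of_subset (Finset.empty_subset _) (by rw [hr.empty]; exact hx0)
      · rw [hi1]
        exact (hx.parallel hr (fun h => he (h ▸ hxA)) (fun h => hf (h ▸ hxA)) hx0).2
    have := hr.le_insert i A
    have := hr.singleton_le_of_mem hjA
    omega
  · push Not at h
    rw [hr.eq_of_forall_insert (Finset.empty_subset A) fun x hxA => ?_, hr.empty]
    rw [hr.empty]
    exact h x hxA (fun h => he (h ▸ hxA)) (fun h => hf (h ▸ hxA))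

/-- Addition in `Fin (m + 1)` is cyclic, so an independent uniform shift makes any distribution
uniform. -/
theorem sum_law_add {m : ℕ} {s : Fin (m + 1) → ℝ} (hs : s ∈ stdSimplex ℝ (Fin (m + 1))) :
    ent (fun ω : Fin (m + 1) × Fin (m + 1) => ((m : ℝ) + 1)⁻¹ * s ω.2) (fun ω => ω.1 + ω.2) =
      Real.log (m + 1) := by
  classical
  have hlaw : ∀ y, law (fun ω : Fin (m + 1) × Fin (m + 1) => ((m : ℝ) + 1)⁻¹ * s ω.2)
      (fun ω => ω.1 + ω.2) y = ((m : ℝ) + 1)⁻¹ := by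
    intro y
    unfold law
    rw [Fintype.sum_prod_type, Finset.sum_comm]
    simp only [← eq_sub_iff_add_eq]
    simp [← Finset.mul_sum, hs.2]
  rw [ent_eq_sum_negMulLog]
  simp only [hlaw]
  exact sum_negMulLog_uniform m

/-- Put a uniform variable at `e`, an independent one of entropy `a` at all non-loops other than
`e`, `f`, and their cyclic sum at `f`. Any two of the three determine the third, while those at `e`
and `f` have entropy `log v` each. -/
theorem IsExceptionalRank.mem_entropyRegion {r : Finset (Fin n) → ℕ} (hr : IsRankFunction r)
    {e f i : Fin n} (hef : e ≠ f) (hx : IsExceptionalRank r e f i) {v : ℕ} (hv : 0 < v) {a : ℝ}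
    (ha : 0 ≤ a) (hav : a ≤ Real.log v) :
    a • realRank r + (Real.log v - a) • pairRank e f ∈ entropyRegion n := by
  obtain ⟨m, rfl⟩ : ∃ m, v = m + 1 := ⟨v - 1, by omega⟩
  push_cast at hav ⊢
  obtain ⟨s, hs, hsa⟩ := exists_sum_negMulLog_eq m ha hav
  have hu := uniform_mem_stdSimplex m
  refine mem_entropyRegion_iff.2 ⟨Fin (m + 1) × Fin (m + 1), inferInstance, fun _ => Fin (m + 1),
    inferInstance, fun j ω => if j = e then ω.1 else if j = f then ω.1 + ω.2 else
      if r {j} = 0 then 0 else ω.2, _, prod_mem_stdSimplex hu hs, fun A => ?_⟩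
  have hker : ∀ ω ω' : Fin (m + 1) × Fin (m + 1),
      subvector (𝒳 := fun _ => Fin (m + 1)) (fun j ω => if j = e then ω.1 else
        if j = f then ω.1 + ω.2 else if r {j} = 0 then 0 else ω.2) A ω =
      subvector (𝒳 := fun _ => Fin (m + 1)) (fun j ω => if j = e then ω.1 else
        if j = f then ω.1 + ω.2 else if r {j} = 0 then 0 else ω.2) A ω' ↔
      (e ∈ A → ω.1 = ω'.1) ∧ (f ∈ A → ω.1 + ω.2 = ω'.1 + ω'.2) ∧
      ((∃ j ∈ A, j ≠ e ∧ j ≠ f ∧ r {j} ≠ 0) → ω.2 = ω'.2) := by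
    intro ω ω'
    rw [subvector_eq_iff]
    constructor
    · intro h
      refine ⟨fun he => by simpa using h e he, fun hf => by simpa [hef.symm] using h f hf, ?_⟩
      rintro ⟨j, hjA, je, jf, hj⟩
      simpa [je, jf, hj] using h j hjA
    · rintro ⟨h1, h2, h3⟩ j hjA
      split_ifs with je jf hj
      · exact h1 (je ▸ hjA)
      · exact h2 (jf ▸ hjA)
      · rfl
      · exact h3 ⟨j, hjA, je, jf, hj⟩
  have hid : ent (fun _ : Fin (m + 1) => ((m : ℝ) + 1)⁻¹) id = Real.log (m + 1) := by
    rw [ent_id, sum_negMulLog_uniform]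
  have hids : ent s id = a := by rw [ent_id, hsa]
  have hfull : ∀ {F : Fin (m + 1) × Fin (m + 1) → ∀ _ : A, Fin (m + 1)},
      (∀ ω ω', F ω = F ω' ↔ ω.1 = ω'.1 ∧ ω.2 = ω'.2) →
      ent (fun ω : Fin (m + 1) × Fin (m + 1) => ((m : ℝ) + 1)⁻¹ * s ω.2) F =
        Real.log (m + 1) + a := by
    intro F hF
    rw [ent_prod hu hs (f := id) (g := id) hF, hid, hids]
  simp only [Pi.add_apply, Pi.smul_apply, smul_eq_mul, realRank, pairRank]
  by_cases he : e ∈ A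
  · rw [hx.rank_of_left hr he, if_pos (Or.inl he)]
    split_ifs with h
    · rw [hfull fun ω ω' => ?_]
      · push_cast; ring
      rw [hker]
      refine ⟨fun ⟨h1, h2, h3⟩ => ⟨h1 he, ?_⟩,
        fun ⟨h1, h2⟩ => ⟨fun _ => h1, fun _ => by rw [h1, h2], fun _ => h2⟩⟩
      rcases h with h | h
      · have := h2 h
        rwa [h1 he, add_right_inj] at this
      · exact h3 h
    · rw [not_or] at h
      rw [ent_prod hu hs (f := id) (g := fun _ => ()) fun ω ω' => ?_, hid,
        ent_of_forall_eq hs fun _ _ => rfl]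
      · push_cast; ring
      rw [hker]
      exact ⟨fun h' => ⟨h'.1 he, rfl⟩, fun h' => ⟨fun _ => h'.1, fun hf => absurd hf h.1,
        fun hj => absurd hj h.2⟩⟩
  by_cases hf : f ∈ A
  · rw [hx.symm.rank_of_left hr hf, if_pos (Or.inr hf)]
    split_ifs with h
    · replace h := h.resolve_left he
      replace h : ∃ j ∈ A, j ≠ e ∧ j ≠ f ∧ r {j} ≠ 0 := by
        obtain ⟨j, h1, h2, h3, h4⟩ := h
        exact ⟨j, h1, h3, h2, h4⟩
      rw [hfull fun ω ω' => ?_]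
      · push_cast; ring
      rw [hker]
      refine ⟨fun ⟨h1, h2, h3⟩ => ⟨?_, h3 h⟩, fun ⟨h1, h2⟩ => ⟨fun _ => h1, fun _ => by rw [h1, h2],
        fun _ => h2⟩⟩
      have := h2 hf
      rwa [h3 h, add_left_inj] at this
    · rw [not_or] at h
      rw [ent_congr (g := fun ω : Fin (m + 1) × Fin (m + 1) => ω.1 + ω.2) fun ω ω' => ?_,
        sum_law_add hs]
      · push_cast; ring
      rw [hker]
      refine ⟨fun h' => h'.2.1 hf, fun h' => ⟨fun h => absurd h he, fun _ => h', ?_⟩⟩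
      rintro ⟨j, h1, h2, h3, h4⟩
      exact absurd ⟨j, h1, h3, h2, h4⟩ h.2
  · rw [hx.rank_of_not_mem hr he hf, if_neg (not_or.2 ⟨he, hf⟩)]
    split_ifs with h
    · rw [ent_prod hu hs (f := fun _ => ()) (g := id) fun ω ω' => ?_, hids,
        ent_of_forall_eq hu fun _ _ => rfl]
      · push_cast; ring
      rw [hker]
      exact ⟨fun h' => ⟨rfl, h'.2.2 h⟩, fun h' => ⟨fun h => absurd h he, fun h => absurd h hf,
        fun _ => h'.2⟩⟩
    · rw [ent_of_forall_eq (prod_mem_stdSimplex hu hs) fun ω ω' => ?_]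
      · push_cast; ring
      rw [hker]
      exact ⟨fun h => absurd h he, fun h => absurd h hf, fun h' => absurd h' h⟩

/-! ### Necessary conditions for entropic points -/

section Faces

variable {r : Finset (Fin n) → ℕ} {e f : Fin n} {a b : ℝ}

/-- The point `(a, b)` of the face. -/
noncomputable def facePoint (r : Finset (Fin n) → ℕ) (e f : Fin n) (a b : ℝ) : EntropySpace n :=
  a • realRank r + b • pairRank e f

theorem facePoint_of_mem {A : Finset (Fin n)} (h : e ∈ A ∨ f ∈ A) :
    facePoint r e f a b A = a * r A + b := by
  simp [facePoint, realRank, pairRank, h]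

theorem facePoint_of_notMem {A : Finset (Fin n)} (he : e ∉ A) (hf : f ∉ A) :
    facePoint r e f a b A = a * r A := by
  simp [facePoint, realRank, pairRank, he, hf]

theorem IsExceptionalRank.log_ceil_exp_le (hr : IsRankFunction r) {i : Fin n}
    (hx : IsExceptionalRank r e f i) (h : facePoint r e f a b ∈ entropyRegion n) :
    Real.log (⌈Real.exp a⌉ : ℝ) ≤ a + b := by
  have hi : r {i} = 1 := by
    have := hr.insert_le e {i}
    have := hr.singleton_le i
    have := hx.left
    omega
  have he : r {e} = 1 := by
    have := hr.insert_le i {e}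
    rw [Finset.pair_comm] at this
    have := hr.singleton_le e
    have := hx.left
    omega
  have hf : r {f} = 1 := by
    have := hr.insert_le i {f}
    rw [Finset.pair_comm] at this
    have := hr.singleton_le f
    have := hx.right
    omega
  have htop : ∀ A : Finset (Fin n), ({e, f} : Finset (Fin n)) ⊆ A → r A = 2 := by
    intro A hA
    have h1 := hr.mono hA
    have h2 := hr.mono (Finset.subset_univ A)
    rw [hx.univ] at h2
    rw [hx.pair] at h1
    omega
  have v1 : facePoint r e f a b {e} = a + b := by
    rw [facePoint_of_mem (by simp), he]; simp
  have v2 : facePoint r e f a b {f} = a + b := by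
    rw [facePoint_of_mem (by simp), hf]; simp
  have v3 : facePoint r e f a b {i} = a := by
    rw [facePoint_of_notMem (by simpa using hx.ne_left.symm) (by simpa using hx.ne_right.symm),
      hi]; simp
  have v4 : facePoint r e f a b ({e} ∪ {i}) = 2 * a + b := by
    rw [facePoint_of_mem (by simp), ← Finset.insert_eq, hx.left]; push_cast; ring
  have v5 : facePoint r e f a b ({f} ∪ {i}) = 2 * a + b := by
    rw [facePoint_of_mem (by simp), ← Finset.insert_eq, hx.right]; push_cast; ring
  have v6 : ∀ A : Finset (Fin n), ({e, f} : Finset (Fin n)) ⊆ A →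
      facePoint r e f a b A = 2 * a + b := by
    intro A hA
    rw [facePoint_of_mem (Or.inl (hA (by simp))), htop A hA]; push_cast; ring
  have := log_ceil_exp_le_of_mem_entropyRegion h (A := {e}) (B := {f}) (C := {i})
    (by rw [v1, v3, v4]; ring) (by rw [v2, v3, v5]; ring)
    (by rw [v4, v6 _ (by intro x; simp; tauto)])
    (by rw [v5, v6 _ (by intro x; simp; tauto)])
    (by rw [v6 _ (by intro x; simp; tauto), v6 _ (by intro x; simp)])
  rwa [v1, v3] at this

/-- As `j`, `k` avoid `e` and `f`, adding them to `Z` leaves the `pairRank` term unchanged, so the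
rank relations of a linked pair become entropy relations with unit `a`. -/
theorem IsLinkedBy.exists_eq_log {j k : Fin n} {Z : Finset (Fin n)}
    (hl : IsLinkedBy r j k Z) (hj : j ∉ ({e, f} : Finset (Fin n)))
    (hk : k ∉ ({e, f} : Finset (Fin n))) (h : facePoint r e f a b ∈ entropyRegion n) :
    ∃ v : ℕ, 0 < v ∧ a = Real.log v := by
  simp only [Finset.mem_insert, Finset.mem_singleton, not_or] at hj hk
  have v1 : facePoint r e f a b {j} = a := by
    rw [facePoint_of_notMem (by simpa using Ne.symm hj.1) (by simpa using Ne.symm hj.2), hl.left]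
    simp
  have v2 : facePoint r e f a b {k} = a := by
    rw [facePoint_of_notMem (by simpa using Ne.symm hk.1) (by simpa using Ne.symm hk.2), hl.right]
    simp
  have v3 : facePoint r e f a b ({j} ∪ {k}) = 2 * a := by
    rw [facePoint_of_notMem (by simpa using ⟨Ne.symm hj.1, Ne.symm hk.1⟩)
      (by simpa using ⟨Ne.symm hj.2, Ne.symm hk.2⟩), ← Finset.insert_eq, hl.pair]
    push_cast; ring
  have hstep : ∀ A : Finset (Fin n), (e ∈ A ↔ e ∈ Z) → (f ∈ A ↔ f ∈ Z) → r A = r Z + 1 →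
      facePoint r e f a b A = a + facePoint r e f a b Z := by
    intro A h1 h2 hA
    simp only [facePoint, Pi.add_apply, Pi.smul_apply, smul_eq_mul, realRank, pairRank, h1, h2, hA]
    push_cast; ring
  have v4 : facePoint r e f a b ({j} ∪ Z) = a + facePoint r e f a b Z :=
    hstep _ (by simp [Ne.symm hj.1]) (by simp [Ne.symm hj.2])
      (by rw [← Finset.insert_eq, hl.insert_left])
  have v5 : facePoint r e f a b ({k} ∪ Z) = a + facePoint r e f a b Z :=
    hstep _ (by simp [Ne.symm hk.1]) (by simp [Ne.symm hk.2])
      (by rw [← Finset.insert_eq, hl.insert_right])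
  have v6 : facePoint r e f a b ({j} ∪ Z ∪ {k}) = a + facePoint r e f a b Z := by
    refine hstep _ (by simp [Ne.symm hk.1, Ne.symm hj.1]) (by simp [Ne.symm hk.2, Ne.symm hj.2]) ?_
    rw [Finset.union_assoc, Finset.union_comm Z, ← Finset.insert_eq, ← Finset.insert_eq,
      hl.insert_pair]
  have v7 : facePoint r e f a b ({k} ∪ Z ∪ {j}) = a + facePoint r e f a b Z := by
    refine hstep _ (by simp [Ne.symm hk.1, Ne.symm hj.1]) (by simp [Ne.symm hk.2, Ne.symm hj.2]) ?_
    rw [Finset.union_comm, ← Finset.insert_eq, ← Finset.insert_eq, hl.insert_pair]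
  have := exists_eq_log_of_mem_entropyRegion h (A := {j}) (B := {k}) (C := Z)
    (by rw [v1, v2, v3]; ring) (by rw [v1, v4]) (by rw [v2, v5]) (by rw [v6, v4]) (by rw [v7, v5])
  rwa [v1] at this

end Faces

/-! ### The classification -/

theorem mainTheorem3 (n : ℕ) (hn : 2 ≤ n) (M : Matroid (Fin n)) (hE : M.E = Set.univ)
    (hrank : 2 ≤ M.eRank) (hray : InExtremeRay M) :
    (IsExceptional M ⟨0, by omega⟩ ⟨1, by omega⟩ →
      IsMatusType (matroidRank M) 2 ∧ ¬ IsChenYeungType (matroidRank M) 2) ∧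
    (¬ IsExceptional M ⟨0, by omega⟩ ⟨1, by omega⟩ →
      IsChenYeungType (matroidRank M) 2 ∧
        ((pCharSet (matroidRank M)).Nonempty → ¬ IsMatusType (matroidRank M) 2)) := by
  have hef : (⟨0, by omega⟩ : Fin n) ≠ ⟨1, by omega⟩ := by simp
  rw [isExceptional_iff hE hef]
  obtain ⟨R, hR, hMR⟩ := hray
  have hr := isRankFunction_natRank M
  have hu : 2 ≤ natRank M Finset.univ := by
    rw [← natRank_univ] at hrank
    exact_mod_cast hrank
  have hface : IsTwoDimFace (matroidRank M) 2 := by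
    unfold IsTwoDimFace
    rw [rankOneUniform_two (by omega) (by omega)]
    exact isFaceOfDim_two hr hR hMR hu
  have hpoint : ∀ a b, IsEntropicPoint (matroidRank M) 2 a b ↔
      facePoint (natRank M) ⟨0, by omega⟩ ⟨1, by omega⟩ a b ∈ entropyRegion n := by
    intro a b
    unfold IsEntropicPoint
    rw [rankOneUniform_two (by omega) (by omega)]
    rfl
  generalize (⟨0, by omega⟩ : Fin n) = e at *
  generalize (⟨1, by omega⟩ : Fin n) = f at *
  constructor
  · rintro ⟨i, hx⟩
    refine ⟨⟨hface, ?_, ?_⟩, ?_⟩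
    · rintro v ⟨hv, -⟩ a b ha hb hab - hav
      rw [hpoint]
      -- Realise `(a, log v - a)` by the cyclic construction and supply the excess of `a + b` over
      -- `log v` by an independent multiple of `u`.
      have := add_mem_entropyRegion
        (hx.mem_entropyRegion hr hef (show 0 < v by omega) ha hav.le)
        (smul_pairRank_mem_entropyRegion e f (show 0 ≤ a + b - Real.log v by linarith))
      rwa [add_assoc, ← add_smul,
        show Real.log v - a + (a + b - Real.log v) = b by ring] at this
    · intro a b _ _ hlt hent
      rw [hpoint] at hent
      exact absurd (hx.log_ceil_exp_le hr hent) (not_le.2 hlt)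
    · rintro ⟨-, -, hneg⟩
      have hlog : 0 < Real.log 2 := Real.log_pos one_lt_two
      -- An entropic point from the cyclic construction with `v = 2`, whose `a` lies strictly
      -- between `log 1` and `log 2`.
      refine hneg (Real.log 2 / 2) (Real.log 2 / 2) (by positivity) (by positivity) ?_ ?_
      · intro v hv heq
        rcases Nat.lt_or_ge v 2 with h | h
        · obtain rfl : v = 1 := by omega
          rw [Nat.cast_one, Real.log_one] at heq
          linarith
        · have : Real.log 2 ≤ Real.log v := Real.log_le_log two_pos (by exact_mod_cast h)
          linarith
      · rw [hpoint]
        have := hx.mem_entropyRegion hr hef (v := 2) two_pos (a := Real.log 2 / 2)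
          (by positivity) (by push_cast; linarith)
        rwa [Nat.cast_ofNat, sub_half] at this
  · intro hne
    have hsep := fun A => no_separator hr hR hMR A
    have hS : 2 ≤ natRank M {e, f}ᶜ := by
      by_contra hlt
      exact hne (exists_isExceptionalRank hr hef hsep hu (by omega))
    obtain ⟨j, k, Z, hj, hk, hl⟩ := exists_linked hr hsep hu hS
    have hneg : ∀ a b : ℝ, (∀ v : ℕ, 0 < v → a ≠ Real.log v) →
        ¬ IsEntropicPoint (matroidRank M) 2 a b := by
      intro a b hav hent
      obtain ⟨v, hv, hva⟩ := hl.exists_eq_log hj hk ((hpoint a b).1 hent)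
      exact hav v hv hva
    refine ⟨⟨hface, ?_, fun a b _ _ => hneg a b⟩, ?_⟩
    · rintro v ⟨-, hv⟩ b hb
      rw [hpoint]
      exact add_mem_entropyRegion hv (smul_pairRank_mem_entropyRegion e f hb.le)
    · rintro ⟨v, hv⟩ ⟨-, hpos, -⟩
      have hv2 : (2 : ℝ) ≤ v := by exact_mod_cast hv.1
      have hlt : Real.log ((v : ℝ) - 1) < Real.log v :=
        Real.log_lt_log (by linarith) (by linarith)
      have h0 : 0 ≤ Real.log ((v : ℝ) - 1) := Real.log_nonneg (by linarith)
      -- With `a` strictly between `log (v - 1)` and `log v` and `b = log v`, the Matúš condition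
      -- would make the point entropic, although `a` is not the logarithm of an integer.
      refine hneg ((Real.log ((v : ℝ) - 1) + Real.log v) / 2) (Real.log v) ?_
        (hpos v hv _ _ (by linarith) (by linarith) (by linarith) (by linarith) (by linarith))
      intro w hw heq
      have hw0 : (0 : ℝ) < w := by exact_mod_cast hw
      rcases Nat.lt_or_ge w v with h | h
      · have : (w : ℝ) + 1 ≤ v := by exact_mod_cast h
        have := Real.log_le_log hw0 (show (w : ℝ) ≤ v - 1 by linarith)
        linarith
      · have := Real.log_le_log (by linarith) (show (v : ℝ) ≤ w by exact_mod_cast h)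
        linarith
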